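/- For a finite abelian group $G$ let $R=\mathbf{Z}[G]$ be its group ring and, for $n\ge 1$, let $\psi^n\colon R\to R$ be the ring endomorphism with $\psi^n(g)=g^n$ for $g\in G$. For a prime number $\ell$ let $\theta^\ell\colon R\to R$ be the operation determined by $\ell\,\theta^\ell(a)=a^\ell-\psi^\ell(a)$. If $R$ is a subring of a commutative ring $S$, the $\lambda$-conductor of $S$ into $R$ is the largest ideal of $S$ that is contained in $R$ and satisfies $\theta^\ell(I)\subseteq I$ for every prime $\ell$. **Theorem.** Let $p\neq q$ be prime numbers, and let $G_1$, $G_2$ be abelian groups of order $p^e$ and $q^f$ with $e,f\ge 0$. Put $R_i=\mathbf{Z}[G_i]$, and let $S_i$ be the integral closure of $R_i$ in $R_i\otimes\mathbf{Q}$. Identify $R_1\otimes R_2$ with $\mathbf{Z}[G_1\times G_2]$ and view it as a subring of $S_1\otimes S_2$ (all tensor products are over $\mathbf{Z}$). Then $S_1\otimes S_2$ is the normalization of $\mathbf{Z}[G_1\times G_2]$, i.e. it is isomorphic, compatibly with the inclusions of $\mathbf{Z}[G_1\times G_2]$, to the integral closure of $\mathbf{Z}[G_1\times G_2]$ in $\mathbf{Z}[G_1\times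 G_2]\otimes\mathbf{Q}$. Moreover, if $I_{i\lambda}$ denotes the $\lambda$-conductor of $S_i$ into $R_i$ for $i=1,2$, then the natural map $I_{1\lambda}\otimes I_{2\lambda}\to S_1\otimes S_2$ is injective, and its image is the $\lambda$-conductor $I_\lambda$ of $S_1\otimes S_2$ into $R_1\otimes R_2$: $$I_\lambda=I_{1\lambda}\otimes I_{2\lambda}.$$ -/

import Mathlib

open scoped TensorProduct

noncomputable section

namespace GroupRing

/-- The normalization of a commutative ring `R` in `R ⊗ ℚ`: the integral closure of `R` there. -/
def Normalization (R : Type*) [CommRing R] : Type _ :=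
  integralClosure R (R ⊗[ℤ] ℚ)

instance (R : Type*) [CommRing R] : CommRing (Normalization R) :=
  inferInstanceAs (CommRing (integralClosure R (R ⊗[ℤ] ℚ)))

instance (R : Type*) [CommRing R] : Algebra R (Normalization R) :=
  inferInstanceAs (Algebra R (integralClosure R (R ⊗[ℤ] ℚ)))

/-- The inclusion of the normalization of `R` into `R ⊗ ℚ`. -/
def Normalization.val (R : Type*) [CommRing R] : Normalization R →ₐ[R] R ⊗[ℤ] ℚ :=
  (integralClosure R (R ⊗[ℤ] ℚ)).val

theorem Normalization.val_injective (R : Type*) [CommRing R] :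
    Function.Injective (Normalization.val R) :=
  Subtype.val_injective

instance (R : Type*) [CommRing R] : Module.IsTorsionFree ℤ (R ⊗[ℤ] ℚ) := by
  refine ⟨fun n hn x y hxy => ?_⟩
  have hn0 : (n : ℚ) ≠ 0 := by exact_mod_cast hn.ne_zero
  have hu : (1 : R) ⊗ₜ[ℤ] ((n : ℚ)⁻¹) * (n : R ⊗[ℤ] ℚ) = 1 := by
    rw [← mul_one (n : R ⊗[ℤ] ℚ), ← zsmul_eq_mul, Algebra.TensorProduct.one_def,
      ← TensorProduct.tmul_smul, Algebra.TensorProduct.tmul_mul_tmul]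
    simp [hn0]
  have h : (n : R ⊗[ℤ] ℚ) * x = (n : R ⊗[ℤ] ℚ) * y := by
    simpa only [zsmul_eq_mul] using hxy
  calc x = (1 : R) ⊗ₜ[ℤ] ((n : ℚ)⁻¹) * (n : R ⊗[ℤ] ℚ) * x := by rw [hu, one_mul]
    _ = (1 : R) ⊗ₜ[ℤ] ((n : ℚ)⁻¹) * (n : R ⊗[ℤ] ℚ) * y := by rw [mul_assoc, h, ← mul_assoc]
    _ = y := by rw [hu, one_mul]

instance (R : Type*) [CommRing R] : Module.IsTorsionFree ℤ (Normalization R) :=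
  Function.Injective.moduleIsTorsionFree (Normalization.val R) (Normalization.val_injective R)
    (fun n x => map_zsmul (Normalization.val R) n x)

/-- The Adams operation `ψⁿ` of the group ring `ℤ[G]`, the ring endomorphism with
`ψⁿ g = gⁿ` for `g ∈ G`. -/
def adams (G : Type*) [CommGroup G] (n : ℕ) : MonoidAlgebra ℤ G →+* MonoidAlgebra ℤ G :=
  MonoidAlgebra.mapDomainRingHom ℤ (powMonoidHom n : G →* G)

theorem adams_single {G : Type*} [CommGroup G] (n : ℕ) (g : G) (c : ℤ) :
    adams G n (MonoidAlgebra.single g c) = MonoidAlgebra.single (g ^ n) c := by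
  simp [adams]

/-- The Frobenius congruence `ψ^ℓ a ≡ a^ℓ` modulo a prime number `ℓ`. -/
theorem exists_theta {G : Type*} [CommGroup G] {l : ℕ} (hl : l.Prime) (a : MonoidAlgebra ℤ G) :
    ∃ b : MonoidAlgebra ℤ G, (l : MonoidAlgebra ℤ G) * b = a ^ l - adams G l a := by
  suffices h : (l : MonoidAlgebra ℤ G) ∣ a ^ l - adams G l a from h.imp fun _ => Eq.symm
  induction a using MonoidAlgebra.induction_linear with
  | zero => simp [hl.ne_zero]
  | add f g hf hg =>
    obtain ⟨r, hr⟩ := exists_add_pow_prime_eq hl f g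
    have h : (f + g) ^ l - adams G l (f + g)
        = (f ^ l - adams G l f) + (g ^ l - adams G l g)
          + (l : MonoidAlgebra ℤ G) * (f * g * r) := by
      rw [hr, map_add]; ring
    rw [h]
    exact dvd_add (dvd_add hf hg) (dvd_mul_right _ _)
  | single g c =>
    have : Fact l.Prime := ⟨hl⟩
    have hc : (l : ℤ) ∣ c ^ l - c := by
      rw [← ZMod.intCast_eq_intCast_iff_dvd_sub]
      simp
    obtain ⟨d, hd⟩ := hc
    refine ⟨MonoidAlgebra.single (g ^ l) d, ?_⟩
    rw [adams_single, MonoidAlgebra.single_pow, ← MonoidAlgebra.single_sub, hd,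
      ← nsmul_eq_mul, ← nsmul_eq_mul, MonoidAlgebra.smul_single]

theorem natCast_mul_cancel {G : Type*} [CommGroup G] {l : ℕ} (hl : l.Prime)
    {a b : MonoidAlgebra ℤ G}
    (h : (l : MonoidAlgebra ℤ G) * a = (l : MonoidAlgebra ℤ G) * b) : a = b := by
  rw [← nsmul_eq_mul, ← nsmul_eq_mul] at h
  ext g
  have h2 := congrArg (fun x : MonoidAlgebra ℤ G => x.coeff g) h
  simp only [MonoidAlgebra.coeff_smul, Finsupp.smul_apply] at h2
  simpa [hl.ne_zero] using h2

/-- The fundamental `λ`-operation `θ^ℓ` of `ℤ[G]` for a prime number `ℓ`: the unique operation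
with `ℓ θ^ℓ(a) = a^ℓ - ψ^ℓ(a)`. -/
def theta {G : Type*} [CommGroup G] {l : ℕ} (hl : l.Prime) (a : MonoidAlgebra ℤ G) :
    MonoidAlgebra ℤ G :=
  (exists_theta hl a).choose

theorem theta_spec {G : Type*} [CommGroup G] {l : ℕ} (hl : l.Prime) (a : MonoidAlgebra ℤ G) :
    (l : MonoidAlgebra ℤ G) * theta hl a = a ^ l - adams G l a :=
  (exists_theta hl a).choose_spec

theorem theta_unique {G : Type*} [CommGroup G] {l : ℕ} (hl : l.Prime) {a b : MonoidAlgebra ℤ G}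
    (h : (l : MonoidAlgebra ℤ G) * b = a ^ l - adams G l a) : theta hl a = b :=
  natCast_mul_cancel hl ((theta_spec hl a).trans h.symm)

/-- For an inclusion `f : ℤ[G] → S` of rings: `I` is an ideal of `S` that is contained in `ℤ[G]`
and stable under all fundamental `λ`-operations `θ^ℓ`. -/
def IsLambdaIdeal {G S : Type*} [CommGroup G] [CommRing S] (f : MonoidAlgebra ℤ G →+* S)
    (I : Ideal S) : Prop :=
  (∀ x ∈ I, ∃ a, f a = x) ∧
    ∀ (l : ℕ) (hl : l.Prime) (a : MonoidAlgebra ℤ G), f a ∈ I → f (theta hl a) ∈ I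

/-- The `λ`-conductor of `S` into `ℤ[G]`, for an inclusion `f : ℤ[G] → S`: the largest ideal of
`S` that is contained in `ℤ[G]` and stable under the operations `θ^ℓ`. -/
def lambdaConductor {G S : Type*} [CommGroup G] [CommRing S] (f : MonoidAlgebra ℤ G →+* S) :
    Ideal S :=
  sSup {I | IsLambdaIdeal f I}

theorem theta_zero {G : Type*} [CommGroup G] {l : ℕ} (hl : l.Prime) :
    theta hl (0 : MonoidAlgebra ℤ G) = 0 :=
  theta_unique hl (by simp [hl.ne_zero])

theorem exists_theta_add {G : Type*} [CommGroup G] {l : ℕ} (hl : l.Prime)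
    (a b : MonoidAlgebra ℤ G) :
    ∃ r, theta hl (a + b) = theta hl a + theta hl b + a * r := by
  obtain ⟨r, hr⟩ := exists_add_pow_prime_eq hl a b
  refine ⟨b * r, theta_unique hl ?_⟩
  rw [mul_add, mul_add, theta_spec, theta_spec, hr, map_add]
  ring

theorem IsLambdaIdeal.bot {G S : Type*} [CommGroup G] [CommRing S]
    {f : MonoidAlgebra ℤ G →+* S} (hf : Function.Injective f) : IsLambdaIdeal f ⊥ := by
  refine ⟨fun x hx => ⟨0, by simpa using hx.symm⟩, fun l hl a ha => ?_⟩
  have : a = 0 := hf (by simpa using ha)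
  simp [this, theta_zero]

theorem IsLambdaIdeal.sup {G S : Type*} [CommGroup G] [CommRing S]
    {f : MonoidAlgebra ℤ G →+* S} (hf : Function.Injective f) {I J : Ideal S}
    (hI : IsLambdaIdeal f I) (hJ : IsLambdaIdeal f J) : IsLambdaIdeal f (I ⊔ J) := by
  refine ⟨fun x hx => ?_, fun l hl a ha => ?_⟩
  · obtain ⟨u, hu, v, hv, rfl⟩ := Submodule.mem_sup.1 hx
    obtain ⟨a, rfl⟩ := hI.1 u hu
    obtain ⟨b, rfl⟩ := hJ.1 v hv
    exact ⟨a + b, map_add f a b⟩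
  · obtain ⟨u, hu, v, hv, huv⟩ := Submodule.mem_sup.1 ha
    obtain ⟨b, rfl⟩ := hI.1 u hu
    obtain ⟨c, rfl⟩ := hJ.1 v hv
    have hbc : b + c = a := hf (by rw [map_add, huv])
    obtain ⟨r, hr⟩ := exists_theta_add hl b c
    rw [← hbc, hr, map_add, map_add, map_mul]
    have h1 : f (theta hl b) ∈ I ⊔ J := Ideal.mem_sup_left (hI.2 l hl b hu)
    have h2 : f (theta hl c) ∈ I ⊔ J := Ideal.mem_sup_right (hJ.2 l hl c hv)
    have h3 : f b * f r ∈ I ⊔ J := Ideal.mem_sup_left (I.mul_mem_right _ hu)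
    exact add_mem (add_mem h1 h2) h3

/-- The `λ`-conductor is indeed the largest such ideal. -/
theorem isGreatest_lambdaConductor {G S : Type*} [CommGroup G] [CommRing S]
    {f : MonoidAlgebra ℤ G →+* S} (hf : Function.Injective f) :
    IsGreatest {I | IsLambdaIdeal f I} (lambdaConductor f) := by
  have key : ∀ x ∈ lambdaConductor f, ∃ I, IsLambdaIdeal f I ∧ x ∈ I := by
    intro x hx
    have hdir : DirectedOn (· ≤ ·) {I | IsLambdaIdeal f I} := fun I hI J hJ =>
      ⟨I ⊔ J, IsLambdaIdeal.sup hf hI hJ, le_sup_left, le_sup_right⟩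
    simpa using (Submodule.mem_sSup_of_directed ⟨⊥, IsLambdaIdeal.bot hf⟩ hdir).1 hx
  refine ⟨⟨fun x hx => ?_, fun l hl a ha => ?_⟩, fun I hI => le_sSup hI⟩
  · obtain ⟨I, hI, hxI⟩ := key x hx
    exact hI.1 x hxI
  · obtain ⟨I, hI, haI⟩ := key _ ha
    exact (le_sSup hI : I ≤ lambdaConductor f) (hI.2 l hl a haI)

/-- The identification `ℤ[G₁ × G₂] = ℤ[G₁] ⊗ ℤ[G₂]`, `(g₁, g₂) ↦ g₁ ⊗ g₂`. -/
def prodEquivTensor (G₁ G₂ : Type*) [CommGroup G₁] [CommGroup G₂] :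
    MonoidAlgebra ℤ (G₁ × G₂) ≃ₐ[ℤ] MonoidAlgebra ℤ G₁ ⊗[ℤ] MonoidAlgebra ℤ G₂ :=
  AlgEquiv.ofAlgHom
    (MonoidAlgebra.lift ℤ _ (G₁ × G₂)
      { toFun := fun g => MonoidAlgebra.of ℤ G₁ g.1 ⊗ₜ[ℤ] MonoidAlgebra.of ℤ G₂ g.2
        map_one' := by simp [Algebra.TensorProduct.one_def, MonoidAlgebra.one_def]
        map_mul' := fun g h => by simp [Algebra.TensorProduct.tmul_mul_tmul] })
    (Algebra.TensorProduct.productMap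
      (MonoidAlgebra.mapDomainAlgHom ℤ ℤ (MonoidHom.inl G₁ G₂))
      (MonoidAlgebra.mapDomainAlgHom ℤ ℤ (MonoidHom.inr G₁ G₂)))
    (by
      ext g
      · simp [MonoidAlgebra.one_def]
      · simp [MonoidAlgebra.one_def])
    (by
      ext g
      simp)

/-- The inclusion of `ℤ[G]` into its normalization. -/
def toNormalization (G : Type*) [CommGroup G] :
    MonoidAlgebra ℤ G →+* Normalization (MonoidAlgebra ℤ G) :=
  algebraMap _ _

/-- The inclusion `ℤ[G₁ × G₂] = R₁ ⊗ R₂ → S₁ ⊗ S₂`, where `Sᵢ` is the normalization of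
`Rᵢ = ℤ[Gᵢ]`. -/
def toTensorNormalization (G₁ G₂ : Type*) [CommGroup G₁] [CommGroup G₂] :
    MonoidAlgebra ℤ (G₁ × G₂) →+*
      Normalization (MonoidAlgebra ℤ G₁) ⊗[ℤ] Normalization (MonoidAlgebra ℤ G₂) :=
  (Algebra.TensorProduct.map (toNormalization G₁).toIntAlgHom
    (toNormalization G₂).toIntAlgHom).toRingHom.comp
    (prodEquivTensor G₁ G₂).toRingEquiv.toRingHom

theorem toNormalization_injective (G : Type*) [CommGroup G] :
    Function.Injective (toNormalization G) := by
  have h : Function.Injective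
      (Algebra.TensorProduct.includeLeft : MonoidAlgebra ℤ G →ₐ[ℤ] MonoidAlgebra ℤ G ⊗[ℤ] ℚ) :=
    Algebra.TensorProduct.includeLeft_injective (RingHom.injective_int (algebraMap ℤ ℚ))
  intro a b hab
  exact h (congrArg (Normalization.val _) hab)

theorem toTensorNormalization_injective (G₁ G₂ : Type*) [CommGroup G₁] [CommGroup G₂] :
    Function.Injective (toTensorNormalization G₁ G₂) := by
  have h := TensorProduct.map_injective_of_flat_flat
    (toNormalization G₁).toIntAlgHom.toLinearMap (toNormalization G₂).toIntAlgHom.toLinearMap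
    (toNormalization_injective G₁) (toNormalization_injective G₂)
  exact h.comp (prodEquivTensor G₁ G₂).injective

end GroupRing

end

/-! Let `K_i` be the ideal `reducedConductor G_i`: the conductor of `S_i` into `R_i`, cut down to
the elements killed by the norm element `N_i = ∑ g` when `G_i` is nontrivial. The formula for `I_λ`
follows from the chain `I_λ ⊆ K₁ ⊗ K₂ ⊆ I₁λ ⊗ I₂λ ⊆ I_λ`.

First inclusion: a descent based on `θ^p` shows that any `λ`-ideal of `S₁ ⊗ S₂` is killed by `N₁`
and `N₂` (`norm_mul_eq_zero_of_isLambdaIdeal`). Its coordinates with respect to a `ℤ`-basis of one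
tensor factor then lie in the reduced conductor of the other (`IsLambdaIdeal.le_tensorIdeal`).

Second inclusion: `K_i` is itself a `λ`-ideal (`InConductor.theta`). For a `p`-group, `S` is
generated over `R` by the idempotents of subgroups (`mem_adjoin_idem`), so the conductor can be
tested on them. At `ℓ = p` both `x^p` and `ψ^p x` become divisible by `p` after multiplication by
the idempotent of a proper nontrivial subgroup; the whole group is handled by the norm condition. At
`ℓ ≠ p` one uses that `ℓ` is prime to `|G|`.

Third inclusion: a tensor product of `λ`-ideals is a `λ`-ideal, by the product rule for `θ^ℓ`.

For the normalization, Fourier inversion shows that `|G₁| x` and `|G₂| x` lie in `S₁ ⊗ S₂` for every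
integral `x` in `ℚ[G₁ × G₂]`; the two orders are coprime. -/

noncomputable section

namespace GroupRing

/-! ### Complex characters and Fourier inversion -/

section Characters

variable {A : Type*} [CommGroup A]

/-- The ring homomorphism `k[A] → k'` that extends `f : k → k'` by a complex character of `A`. -/
def charHom {k k' : Type*} [CommRing k] [CommRing k'] [Algebra ℂ k'] (f : k →+* k')
    (χ : A →* ℂˣ) : MonoidAlgebra k A →+* k' :=
  MonoidAlgebra.liftNCRingHom f
    (((algebraMap ℂ k' : ℂ →+* k') : ℂ →* k').comp ((Units.coeHom ℂ).comp χ))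
    (fun _ _ => Commute.all _ _)

theorem charHom_single {k k' : Type*} [CommRing k] [CommRing k'] [Algebra ℂ k'] (f : k →+* k')
    (χ : A →* ℂˣ) (a : A) (c : k) :
    charHom f χ (MonoidAlgebra.single a c) = f c * algebraMap ℂ k' (χ a) := by
  simp [charHom]

variable [Finite A]

theorem sum_char [Fintype (A →* ℂˣ)] [DecidableEq A] (a : A) :
    ∑ χ : A →* ℂˣ, (χ a : ℂ) = if a = 1 then (Nat.card A : ℂ) else 0 := by
  have : NeZero (Monoid.exponent A) := ⟨Monoid.exponent_ne_zero_of_finite⟩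
  split_ifs with h
  · subst h
    simp [← CommGroup.card_monoidHom_of_hasEnoughRootsOfUnity A ℂ]
  · obtain ⟨φ, hφ⟩ := CommGroup.exists_apply_ne_one_of_hasEnoughRootsOfUnity A ℂ h
    have h1 : (φ a : ℂ) * ∑ χ : A →* ℂˣ, (χ a : ℂ) = ∑ χ : A →* ℂˣ, (χ a : ℂ) := by
      rw [Finset.mul_sum]
      exact Fintype.sum_equiv (Equiv.mulLeft φ) _ _ (fun χ => by simp)
    have h2 : ((φ a : ℂ) - 1) * ∑ χ : A →* ℂˣ, (χ a : ℂ) = 0 := by rw [sub_mul, h1, one_mul, sub_self]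
    refine (mul_eq_zero.1 h2).resolve_left (fun h3 => hφ ?_)
    exact Units.ext (by simpa using sub_eq_zero.1 h3)

instance : Finite (A →* ℂˣ) := by
  have : NeZero (Monoid.exponent A) := ⟨Monoid.exponent_ne_zero_of_finite⟩
  exact Nat.finite_of_card_ne_zero (by
    rw [CommGroup.card_monoidHom_of_hasEnoughRootsOfUnity A ℂ]; exact Nat.card_pos.ne')

/-- Fourier inversion, from orthogonality of characters. The coefficients are general because both
`ℚ → ℂ` and `ℚ[B] → ℂ[B]` occur later. -/
theorem sum_charHom {k k' : Type*} [CommRing k] [CommRing k'] [Algebra ℂ k'] (f : k →+* k')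
    [Fintype (A →* ℂˣ)] (x : MonoidAlgebra k A) (a : A) :
    ∑ χ : A →* ℂˣ, charHom f χ (MonoidAlgebra.single a⁻¹ 1 * x)
      = f ((Nat.card A : k) * x.coeff a) := by
  classical
  induction x using MonoidAlgebra.induction_linear with
  | zero => simp
  | add x y hx hy => simp only [mul_add, map_add, Finset.sum_add_distrib, hx, hy,
      MonoidAlgebra.coeff_add, Finsupp.add_apply]
  | single b c =>
    simp only [MonoidAlgebra.single_mul_single, charHom_single, one_mul]
    rw [← Finset.mul_sum, ← map_sum, sum_char]
    by_cases h : a = b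
    · subst h
      simp [mul_comm]
    · rw [if_neg (by rw [inv_mul_eq_one]; exact h), MonoidAlgebra.coeff_single,
        Finsupp.single_apply, if_neg (Ne.symm h)]
      simp

/-- Inversion writes the image under `f` as a sum of character values of `a⁻¹ x`, which is integral
since `a` has finite order; an injective `f` reflects integrality. -/
theorem isIntegral_card_mul_coeff {k k' : Type*} [CommRing k] [CommRing k'] [Algebra ℂ k']
    (f : k →+* k') (hf : Function.Injective f) {x : MonoidAlgebra k A} (hx : IsIntegral ℤ x)
    (a : A) : IsIntegral ℤ ((Nat.card A : k) * x.coeff a) := by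
  have := Fintype.ofFinite (A →* ℂˣ)
  rw [← isIntegral_algHom_iff f.toIntAlgHom hf]
  change IsIntegral ℤ (f _)
  rw [← sum_charHom f x a]
  refine IsIntegral.sum _ (fun χ _ => ?_)
  refine IsIntegral.map (charHom f χ).toIntAlgHom (IsIntegral.mul ?_ hx)
  refine IsIntegral.of_pow (n := Nat.card A) Nat.card_pos ?_
  rw [MonoidAlgebra.single_pow, pow_card_eq_one', one_pow]
  exact isIntegral_one

end Characters

/-! ### The rational group ring and the idempotents of subgroups -/

section RationalGroupRing

variable {G : Type*} [CommGroup G]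

/-- The inclusion `ℤ[G] → ℚ[G]`. -/
def toRat (G : Type*) [CommGroup G] : MonoidAlgebra ℤ G →+* MonoidAlgebra ℚ G :=
  MonoidAlgebra.mapRingHom G (Int.castRingHom ℚ)

@[simp] theorem toRat_single (g : G) (c : ℤ) :
    toRat G (MonoidAlgebra.single g c) = MonoidAlgebra.single g (c : ℚ) := by
  simp [toRat]

theorem toRat_injective : Function.Injective (toRat G) :=
  MonoidAlgebra.map_injective (Int.castAddHom ℚ) Int.cast_injective

theorem mem_range_toRat {x : MonoidAlgebra ℚ G} :
    x ∈ (toRat G).range ↔ ∀ g, ∃ n : ℤ, (n : ℚ) = x.coeff g := by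
  have := Set.ext_iff.1 (MonoidAlgebra.range_map (M := G) (Int.castAddHom ℚ)) x
  exact this

theorem isIntegral_single_one [Finite G] {k : Type*} [CommRing k] (g : G) :
    IsIntegral ℤ (MonoidAlgebra.single g 1 : MonoidAlgebra k G) := by
  refine IsIntegral.of_pow (n := Nat.card G) Nat.card_pos ?_
  rw [MonoidAlgebra.single_pow, pow_card_eq_one', one_pow]
  exact isIntegral_one

theorem isIntegral_int [Finite G] (x : MonoidAlgebra ℤ G) : IsIntegral ℤ x := by
  induction x using MonoidAlgebra.induction_linear with
  | zero => exact isIntegral_zero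
  | add x y hx hy => exact hx.add hy
  | single g c =>
    have : MonoidAlgebra.single g c = c • (MonoidAlgebra.single g 1 : MonoidAlgebra ℤ G) := by
      simp
    rw [this]
    exact (isIntegral_single_one g).smul c

theorem isIntegral_toRat [Finite G] (x : MonoidAlgebra ℤ G) : IsIntegral ℤ (toRat G x) :=
  (isIntegral_int x).map (toRat G).toIntAlgHom

theorem card_mul_mem_range_toRat [Finite G] {s : MonoidAlgebra ℚ G} (hs : IsIntegral ℤ s) :
    (Nat.card G : MonoidAlgebra ℚ G) * s ∈ (toRat G).range := by
  rw [mem_range_toRat]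
  intro g
  have := isIntegral_card_mul_coeff (algebraMap ℚ ℂ) (algebraMap ℚ ℂ).injective hs g
  obtain ⟨n, hn⟩ := IsIntegrallyClosed.isIntegral_iff.1 this
  refine ⟨n, ?_⟩
  rw [← nsmul_eq_mul, MonoidAlgebra.coeff_smul, Finsupp.smul_apply, nsmul_eq_mul]
  exact hn

/-- Evaluation of a complex character on `ℚ[G]`. -/
def ev (χ : G →* ℂˣ) : MonoidAlgebra ℚ G →+* ℂ := charHom (algebraMap ℚ ℂ) χ

theorem ev_single (χ : G →* ℂˣ) (g : G) (c : ℚ) :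
    ev χ (MonoidAlgebra.single g c) = c * χ g := by
  simp [ev, charHom_single]

theorem ext_ev [Finite G] {x y : MonoidAlgebra ℚ G} (h : ∀ χ, ev χ x = ev χ y) : x = y := by
  have := Fintype.ofFinite (G →* ℂˣ)
  ext g
  have h1 := sum_charHom (algebraMap ℚ ℂ) x g
  have h2 := sum_charHom (algebraMap ℚ ℂ) y g
  have h3 : ∀ χ, charHom (algebraMap ℚ ℂ) χ (MonoidAlgebra.single g⁻¹ 1 * x) =
      charHom (algebraMap ℚ ℂ) χ (MonoidAlgebra.single g⁻¹ 1 * y) := fun χ => by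
    rw [map_mul, map_mul]; congr 1; exact h χ
  simp only [h3] at h1
  have h4 := (algebraMap ℚ ℂ).injective (h1.symm.trans h2)
  exact mul_left_cancel₀ (by exact_mod_cast Nat.card_pos.ne') h4

theorem natCast_mul_cancel_rat {n : ℕ} (hn : n ≠ 0) {a b : MonoidAlgebra ℚ G}
    (h : (n : MonoidAlgebra ℚ G) * a = n * b) : a = b := by
  rw [← nsmul_eq_mul, ← nsmul_eq_mul] at h
  ext g
  have h2 := congrArg (fun x : MonoidAlgebra ℚ G => x.coeff g) h
  simp only [MonoidAlgebra.coeff_smul, Finsupp.smul_apply] at h2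
  simpa [hn] using h2

/-- `ψⁿ` on `ℚ[G]`. -/
def adamsRat (G : Type*) [CommGroup G] (n : ℕ) : MonoidAlgebra ℚ G →+* MonoidAlgebra ℚ G :=
  MonoidAlgebra.mapDomainRingHom ℚ (powMonoidHom n : G →* G)

theorem adamsRat_single (n : ℕ) (g : G) (c : ℚ) :
    adamsRat G n (MonoidAlgebra.single g c) = MonoidAlgebra.single (g ^ n) c := by
  simp [adamsRat]

theorem toRat_adams (n : ℕ) (x : MonoidAlgebra ℤ G) :
    toRat G (adams G n x) = adamsRat G n (toRat G x) := by
  induction x using MonoidAlgebra.induction_linear with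
  | zero => simp
  | add x y hx hy => simp [hx, hy]
  | single g c => simp [adams_single, adamsRat_single]

theorem ev_adamsRat (χ : G →* ℂˣ) (n : ℕ) (x : MonoidAlgebra ℚ G) :
    ev χ (adamsRat G n x) = ev (χ ^ n) x := by
  induction x using MonoidAlgebra.induction_linear with
  | zero => simp
  | add x y hx hy => simp [hx, hy]
  | single g c => simp [ev_single, adamsRat_single]

variable [Finite G]

open Classical in
/-- The norm element `∑_{h ∈ H} h` of a subgroup. -/
def norm (H : Subgroup G) : MonoidAlgebra ℤ G :=
  letI := Fintype.ofFinite H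
  ∑ h : H, MonoidAlgebra.single (h : G) 1

theorem norm_eq (H : Subgroup G) [Fintype H] :
    norm H = ∑ h : H, MonoidAlgebra.single (h : G) (1 : ℤ) := by
  unfold norm
  congr!

/-- The idempotent `|H|⁻¹ ∑_{h ∈ H} h`. -/
def idem (H : Subgroup G) : MonoidAlgebra ℚ G :=
  (Nat.card H : ℚ)⁻¹ • toRat G (norm H)

theorem card_mul_idem (H : Subgroup G) :
    (Nat.card H : MonoidAlgebra ℚ G) * idem H = toRat G (norm H) := by
  rw [idem, ← nsmul_eq_mul, ← Nat.cast_smul_eq_nsmul ℚ, smul_smul, mul_inv_cancel₀, one_smul]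
  exact_mod_cast Nat.card_pos.ne'

open Classical in
theorem ev_norm (χ : G →* ℂˣ) (H : Subgroup G) :
    ev χ (toRat G (norm H)) = if H ≤ χ.ker then (Nat.card H : ℂ) else 0 := by
  have := Fintype.ofFinite H
  rw [norm_eq, map_sum, map_sum]
  simp only [toRat_single, ev_single, Int.cast_one, Rat.cast_one, one_mul]
  split_ifs with h
  · have : ∀ x : H, (χ x : ℂ) = 1 := fun x => by
      simpa using congrArg Units.val (h x.2 : χ x = 1)
    simp [this]
  · obtain ⟨g, hg, hg1⟩ := SetLike.not_le_iff_exists.1 h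
    have h1 : (χ g : ℂ) * ∑ x : H, (χ x : ℂ) = ∑ x : H, (χ x : ℂ) := by
      rw [Finset.mul_sum]
      exact Fintype.sum_equiv (Equiv.mulLeft (⟨g, hg⟩ : H)) _ _ (fun x => by simp)
    have h2 : ((χ g : ℂ) - 1) * ∑ x : H, (χ x : ℂ) = 0 := by rw [sub_mul, h1, one_mul, sub_self]
    refine (mul_eq_zero.1 h2).resolve_left (fun h3 => hg1 ?_)
    exact Units.ext (by simpa using sub_eq_zero.1 h3)

open Classical in
theorem ev_idem (χ : G →* ℂˣ) (H : Subgroup G) :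
    ev χ (idem H) = if H ≤ χ.ker then 1 else 0 := by
  have h := ev_norm χ H
  have hc : (Nat.card H : ℂ) ≠ 0 := by exact_mod_cast Nat.card_pos.ne'
  rw [← card_mul_idem, map_mul, map_natCast] at h
  apply mul_left_cancel₀ hc
  rw [h]
  split_ifs <;> simp

theorem idem_mul_idem (H K : Subgroup G) : idem H * idem K = idem (H ⊔ K) := by
  refine ext_ev fun χ => ?_
  rw [map_mul, ev_idem, ev_idem, ev_idem]
  by_cases h1 : H ≤ χ.ker <;> by_cases h2 : K ≤ χ.ker <;> simp [h1, h2]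

theorem idem_bot : idem (⊥ : Subgroup G) = 1 := by
  refine ext_ev fun χ => ?_
  rw [ev_idem, if_pos bot_le, map_one]

theorem isIntegral_idem (H : Subgroup G) : IsIntegral ℤ (idem H) := by
  have h : idem H * idem H - idem H = 0 := by rw [idem_mul_idem, sup_idem, sub_self]
  refine ⟨Polynomial.X ^ 2 - Polynomial.X, by monicity!, ?_⟩
  simpa [pow_two] using h

theorem single_mul_idem (H : Subgroup G) {h : G} (hh : h ∈ H) :
    MonoidAlgebra.single h 1 * idem H = idem H := by
  refine ext_ev fun χ => ?_
  rw [map_mul, ev_idem, ev_single]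
  split_ifs with h1
  · have : χ h = 1 := h1 hh
    simp [this]
  · simp

end RationalGroupRing

/-! ### The integral closure of `ℤ[G]` for an abelian `p`-group -/

section PGroup

variable {G : Type*} [CommGroup G] [Finite G]

/-- The integers of a prime power cyclotomic field are polynomials in the root of unity. -/
theorem mem_adjoin_of_isIntegral {p k : ℕ} (hp : p.Prime) {ζ : ℂ} (hζ : IsPrimitiveRoot ζ (p ^ k))
    {z : ℂ} (hz : IsIntegral ℤ z) (hz' : z ∈ Algebra.adjoin ℚ {ζ}) :
    z ∈ Algebra.adjoin ℤ ({ζ} : Set ℂ) := by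
  have : Fact p.Prime := ⟨hp⟩
  have : NeZero (p ^ k) := ⟨pow_ne_zero _ hp.ne_zero⟩
  have hζi : IsIntegral ℚ ζ := (hζ.isIntegral (NeZero.pos _)).tower_top
  let K := IntermediateField.adjoin ℚ ({ζ} : Set ℂ)
  have hK : K.toSubalgebra = Algebra.adjoin ℚ {ζ} :=
    IntermediateField.adjoin_simple_toSubalgebra_of_isAlgebraic hζi.isAlgebraic
  have hcyc : IsCyclotomicExtension {p ^ k} ℚ K := by
    change IsCyclotomicExtension {p ^ k} ℚ K.toSubalgebra
    rw [hK]
    exact hζ.adjoin_isCyclotomicExtension ℚ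
  have hzK : z ∈ K := by
    change z ∈ K.toSubalgebra
    rwa [hK]
  let ζ' : K := ⟨ζ, IntermediateField.mem_adjoin_simple_self ℚ ζ⟩
  have hζ' : IsPrimitiveRoot ζ' (p ^ k) :=
    IsPrimitiveRoot.of_map_of_injective (f := K.val) hζ K.val.injective
  have h := IsCyclotomicExtension.Rat.isIntegralClosure_adjoin_singleton_of_prime_pow hζ'
  have hz2 : IsIntegral ℤ (⟨z, hzK⟩ : K) := by
    rw [← isIntegral_algHom_iff (K.val.restrictScalars ℤ) K.val.injective]
    exact hz
  obtain ⟨y, hy⟩ := (h.isIntegral_iff).1 hz2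
  have h3 : K.val.restrictScalars ℤ (y : K) ∈
      (Algebra.adjoin ℤ ({ζ'} : Set K)).map (K.val.restrictScalars ℤ) := ⟨y, y.2, rfl⟩
  rw [AlgHom.map_adjoin, Set.image_singleton] at h3
  have h4 : (y : K) = ⟨z, hzK⟩ := hy
  rw [h4] at h3
  exact h3

/-- A character of a `p`-group is generated by one of its values. -/
theorem exists_generator {p e : ℕ} (hp : p.Prime) (hG : Nat.card G = p ^ e) (χ : G →* ℂˣ) :
    ∃ (g₀ : G) (k : ℕ), IsPrimitiveRoot (χ g₀ : ℂ) (p ^ k) ∧ ∀ g, ∃ i : ℕ, χ g = χ g₀ ^ i := by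
  have : Finite χ.range := Set.finite_range χ
  obtain ⟨⟨_, g₀, rfl⟩, hz⟩ := IsCyclic.exists_generator (α := χ.range)
  have h1 : χ g₀ ^ p ^ e = 1 := by
    rw [← map_pow, ← hG, pow_card_eq_one', map_one]
  obtain ⟨k, -, hk⟩ := (Nat.dvd_prime_pow hp).1 (orderOf_dvd_of_pow_eq_one h1)
  refine ⟨g₀, k, ?_, fun g => ?_⟩
  · rw [← hk, IsPrimitiveRoot.coe_units_iff]
    exact IsPrimitiveRoot.orderOf _
  · have h2 := hz ⟨χ g, g, rfl⟩
    rw [mem_zpowers_iff_mem_range_orderOf] at h2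
    obtain ⟨i, -, hi⟩ := Finset.mem_image.1 h2
    exact ⟨i, (congrArg Subtype.val hi).symm⟩

open Classical in
/-- The idempotent of `ℚ[G]` that belongs to the Galois orbit of a character `χ`. -/
def galoisIdem (p : ℕ) (χ : G →* ℂˣ) : MonoidAlgebra ℚ G :=
  if χ = 1 then idem ⊤ else idem χ.ker - idem (χ ^ p).ker

/-- The image of `χ` is cyclic of `p`-power order, so the subgroups above `χ.ker` form a chain, and
for `χ ≠ 1` the next one is `(χ ^ p).ker`. The difference of idempotents thus detects exactly the
characters with the kernel of `χ`. For `χ = 1` the two kernels coincide, hence the separate case. -/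
theorem ev_galoisIdem_self {p e : ℕ} (hp : p.Prime) (hG : Nat.card G = p ^ e) (χ : G →* ℂˣ) :
    ev χ (galoisIdem p χ) = 1 := by
  obtain ⟨g₀, k, hk, hg⟩ := exists_generator hp hG χ
  unfold galoisIdem
  split_ifs with h
  · subst h
    rw [ev_idem, if_pos]
    simp
  · rw [map_sub, ev_idem, ev_idem, if_pos le_rfl, if_neg, sub_zero]
    intro hle
    rw [IsPrimitiveRoot.coe_units_iff] at hk
    obtain _ | k := k
    · apply h
      ext g
      obtain ⟨i, hi⟩ := hg g
      simp only [pow_zero, IsPrimitiveRoot.one_right_iff] at hk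
      simp [hi, hk]
    · have h1 : g₀ ^ p ^ k ∈ (χ ^ p).ker := by
        rw [MonoidHom.mem_ker, MonoidHom.pow_apply, map_pow, ← pow_mul, ← pow_succ]
        exact hk.pow_eq_one
      have h2 := hle h1
      rw [MonoidHom.mem_ker, map_pow] at h2
      exact hk.pow_ne_one_of_pos_of_lt (pow_ne_zero _ hp.ne_zero)
        (Nat.pow_lt_pow_right hp.one_lt k.lt_succ_self) h2

/-- Such an `η` factors through the cyclic group `χ(G)`, so it is determined by `η g₀`; being
nontrivial on `(χ ^ p).ker` forces this value to have full order. -/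
theorem isPrimitiveRoot_of_ev_galoisIdem_ne_zero {p : ℕ} (hp : p.Prime) {χ η : G →* ℂˣ}
    {g₀ : G} {k : ℕ} (hk : IsPrimitiveRoot (χ g₀ : ℂ) (p ^ k)) (hg : ∀ g, ∃ i : ℕ, χ g = χ g₀ ^ i)
    (h : ev η (galoisIdem p χ) ≠ 0) :
    χ.ker ≤ η.ker ∧ IsPrimitiveRoot (η g₀ : ℂ) (p ^ k) := by
  rw [IsPrimitiveRoot.coe_units_iff] at hk ⊢
  unfold galoisIdem at h
  split_ifs at h with h1
  · subst h1
    rw [ev_idem] at h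
    have h2 : (⊤ : Subgroup G) ≤ η.ker := by
      by_contra h3
      simp [h3] at h
    have h3 : η = 1 := MonoidHom.ext fun g => h2 (Subgroup.mem_top g)
    subst h3
    exact ⟨le_rfl, hk⟩
  · rw [map_sub, ev_idem, ev_idem] at h
    have hkk : χ.ker ≤ (χ ^ p).ker := fun g hg => by
      rw [MonoidHom.mem_ker] at hg
      simp [MonoidHom.mem_ker, hg]
    have h2 : χ.ker ≤ η.ker := by
      by_contra h3
      have h4 : ¬ (χ ^ p).ker ≤ η.ker := fun h5 => h3 (hkk.trans h5)
      simp [h3, h4] at h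
    have h3 : ¬ (χ ^ p).ker ≤ η.ker := fun h4 => by simp [h2, h4] at h
    refine ⟨h2, ?_⟩
    have hpow : ∀ (g : G) (i : ℕ), χ g = χ g₀ ^ i → η g = η g₀ ^ i := fun g i hi => by
      have : g * (g₀ ^ i)⁻¹ ∈ χ.ker := by
        rw [MonoidHom.mem_ker, map_mul, map_inv, map_pow, hi, mul_inv_cancel]
      have := h2 this
      rwa [MonoidHom.mem_ker, map_mul, map_inv, map_pow, mul_inv_eq_one] at this
    obtain _ | k := k
    · exfalso
      apply h1
      ext g
      obtain ⟨i, hi⟩ := hg g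
      simp only [pow_zero, IsPrimitiveRoot.one_right_iff] at hk
      simp [hi, hk]
    · have : Fact p.Prime := ⟨hp⟩
      have hord : orderOf (η g₀) = p ^ (k + 1) := by
        refine orderOf_eq_prime_pow (fun h4 => h3 fun g hgp => ?_) ?_
        · obtain ⟨i, hi⟩ := hg g
          rw [MonoidHom.mem_ker, MonoidHom.pow_apply, hi, ← pow_mul] at hgp
          have h5 := (hk.pow_eq_one_iff_dvd _).1 hgp
          rw [pow_succ] at h5
          obtain ⟨j, rfl⟩ := Nat.dvd_of_mul_dvd_mul_right hp.pos h5
          rw [MonoidHom.mem_ker, hpow g _ hi, pow_mul, h4, one_pow]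
        · rw [← map_pow]
          refine h2 ?_
          rw [MonoidHom.mem_ker, map_pow]
          exact hk.pow_eq_one
      rw [← hord]
      exact IsPrimitiveRoot.orderOf _

/-- Galois conjugate characters vanish simultaneously on elements of `ℚ[G]`. -/
theorem ev_eq_zero_of_ev_galoisIdem_ne_zero {p e : ℕ} (hp : p.Prime) (hG : Nat.card G = p ^ e)
    {χ η : G →* ℂˣ} (h : ev η (galoisIdem p χ) ≠ 0) {y : MonoidAlgebra ℚ G} (hy : ev χ y = 0) :
    ev η y = 0 := by
  obtain ⟨g₀, k, hk, hg⟩ := exists_generator hp hG χ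
  obtain ⟨hker, hk'⟩ := isPrimitiveRoot_of_ev_galoisIdem_ne_zero hp hk hg h
  choose i hi using hg
  -- Each `g` is replaced by a power of the variable, so that one rational polynomial computes `ev φ
  -- y` at `φ g₀` for all `φ` trivial on `χ.ker`.
  let Y : Polynomial ℚ := y.coeff.sum fun g c => Polynomial.monomial (i g) c
  have hev : ∀ φ : G →* ℂˣ, χ.ker ≤ φ.ker → Polynomial.aeval (φ g₀ : ℂ) Y = ev φ y := by
    intro φ hφ
    have hφi : ∀ g, φ g = φ g₀ ^ i g := fun g => by
      have : g * (g₀ ^ i g)⁻¹ ∈ χ.ker := by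
        rw [MonoidHom.mem_ker, map_mul, map_inv, map_pow, ← hi, mul_inv_cancel]
      have := hφ this
      rwa [MonoidHom.mem_ker, map_mul, map_inv, map_pow, mul_inv_eq_one] at this
    conv_rhs => rw [← MonoidAlgebra.sum_coeff_single y]
    simp only [Y, Finsupp.sum, map_sum, Polynomial.aeval_monomial, ev_single]
    refine Finset.sum_congr rfl fun g _ => ?_
    rw [hφi g, Units.val_pow_eq_pow_val, eq_ratCast]
  have hpos : 0 < p ^ k := pow_pos hp.pos _
  -- `χ g₀` and `η g₀` share the cyclotomic polynomial of order `p ^ k` as minimal polynomial.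
  have h1 : minpoly ℚ (χ g₀ : ℂ) ∣ Y := minpoly.dvd ℚ _ (by rw [hev χ le_rfl, hy])
  rw [← Polynomial.cyclotomic_eq_minpoly_rat hk hpos,
    Polynomial.cyclotomic_eq_minpoly_rat hk' hpos] at h1
  rw [← hev η hker]
  exact (Polynomial.aeval_eq_zero_of_dvd_aeval_eq_zero h1 (minpoly.aeval ℚ _))

/-- The value is an algebraic integer of `ℚ(ζ)` with `ζ = χ g₀`, hence lies in `ℤ[ζ]`, which `χ`
already reaches from `ℤ[G]`. -/
theorem exists_ev_eq {p e : ℕ} (hp : p.Prime) (hG : Nat.card G = p ^ e) (χ : G →* ℂˣ)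
    {s : MonoidAlgebra ℚ G} (hs : IsIntegral ℤ s) :
    ∃ r : MonoidAlgebra ℤ G, ev χ s = ev χ (toRat G r) := by
  obtain ⟨g₀, k, hk, hg⟩ := exists_generator hp hG χ
  have h1 : ev χ s ∈ Algebra.adjoin ℚ ({(χ g₀ : ℂ)} : Set ℂ) := by
    clear hs
    induction s using MonoidAlgebra.induction_linear with
    | zero => simp
    | add x y hx hy => rw [map_add]; exact add_mem hx hy
    | single g c =>
      obtain ⟨i, hi⟩ := hg g
      rw [ev_single, hi, Units.val_pow_eq_pow_val]
      have := Subalgebra.smul_mem _ (pow_mem (Algebra.self_mem_adjoin_singleton ℚ (χ g₀ : ℂ)) i) c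
      rwa [Algebra.smul_def] at this
  have h2 := mem_adjoin_of_isIntegral hp hk (hs.map (ev χ).toIntAlgHom) h1
  have h3 : Algebra.adjoin ℤ ({(χ g₀ : ℂ)} : Set ℂ) ≤
      ((ev χ).comp (toRat G)).toIntAlgHom.range := by
    refine Algebra.adjoin_le ?_
    rintro _ rfl
    exact ⟨MonoidAlgebra.single g₀ 1, by simp [ev_single]⟩
  obtain ⟨r, hr⟩ := h3 h2
  exact ⟨r, hr.symm⟩

/-- For a finite abelian `p`-group `G`, the integral closure of `ℤ[G]` in `ℚ[G]` is generated by
the idempotents of the subgroups of `G`. -/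
theorem mem_adjoin_idem {p e : ℕ} (hp : p.Prime) (hG : Nat.card G = p ^ e)
    {s : MonoidAlgebra ℚ G} (hs : IsIntegral ℤ s) :
    s ∈ Algebra.adjoin ℤ (Set.range (toRat G) ∪ Set.range (idem (G := G))) := by
  set T := Algebra.adjoin ℤ (Set.range (toRat G) ∪ Set.range (idem (G := G))) with hT
  have hR : ∀ r, toRat G r ∈ T := fun r => Algebra.subset_adjoin (Or.inl ⟨r, rfl⟩)
  have hE : ∀ H : Subgroup G, idem H ∈ T := fun H => Algebra.subset_adjoin (Or.inr ⟨H, rfl⟩)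
  have hf : ∀ χ : G →* ℂˣ, galoisIdem p χ ∈ T := fun χ => by
    unfold galoisIdem
    split_ifs
    · exact hE _
    · exact sub_mem (hE _) (hE _)
  have hfs : ∀ χ : G →* ℂˣ, galoisIdem p χ * s ∈ T := fun χ => by
    obtain ⟨r, hr⟩ := exists_ev_eq hp hG χ hs
    have : galoisIdem p χ * s = galoisIdem p χ * toRat G r := by
      refine ext_ev fun η => ?_
      rw [map_mul, map_mul]
      by_cases h : ev η (galoisIdem p χ) = 0
      · rw [h, zero_mul, zero_mul]
      · congr 1
        rw [← sub_eq_zero, ← map_sub]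
        exact ev_eq_zero_of_ev_galoisIdem_ne_zero hp hG h (by rw [map_sub, hr, sub_self])
    rw [this]
    exact mul_mem (hf χ) (hR r)
  have := Fintype.ofFinite (G →* ℂˣ)
  classical
  -- The full product of the `1 - galoisIdem p χ` vanishes, so it yields a decomposition of `1`
  -- without choosing representatives of the Galois orbits.
  have key : ∀ A : Finset (G →* ℂˣ), ∏ χ ∈ A, (1 - galoisIdem p χ) ∈ T ∧
      (1 - ∏ χ ∈ A, (1 - galoisIdem p χ)) * s ∈ T := by
    intro A
    induction A using Finset.induction_on with
    | empty => simp
    | insert χ A hχ ih =>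
      rw [Finset.prod_insert hχ]
      refine ⟨mul_mem (sub_mem (one_mem _) (hf χ)) ih.1, ?_⟩
      have : (1 - (1 - galoisIdem p χ) * ∏ χ ∈ A, (1 - galoisIdem p χ)) * s
          = (1 - ∏ χ ∈ A, (1 - galoisIdem p χ)) * s
            + (∏ χ ∈ A, (1 - galoisIdem p χ)) * (galoisIdem p χ * s) := by ring
      rw [this]
      exact add_mem ih.2 (mul_mem ih.1 (hfs χ))
  have h0 : ∏ χ : G →* ℂˣ, (1 - galoisIdem p χ) = 0 := by
    refine ext_ev fun η => ?_
    rw [map_prod, map_zero]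
    refine Finset.prod_eq_zero (Finset.mem_univ η) ?_
    rw [map_sub, map_one, ev_galoisIdem_self hp hG, sub_self]
  have := (key Finset.univ).2
  rwa [h0, sub_zero, one_mul] at this

/-- The conductor of the integral closure into `ℤ[G]` is determined by the idempotents of
subgroups. -/
theorem mul_mem_range_of_forall_idem {p e : ℕ} (hp : p.Prime) (hG : Nat.card G = p ^ e)
    {x : MonoidAlgebra ℚ G} (hx : ∀ H : Subgroup G, x * idem H ∈ (toRat G).range)
    {s : MonoidAlgebra ℚ G} (hs : IsIntegral ℤ s) : x * s ∈ (toRat G).range := by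
  -- Keeping `x` universally quantified lets the product case feed `x * s` back into the induction
  -- hypothesis.
  have key : ∀ s ∈ Algebra.adjoin ℤ (Set.range (toRat G) ∪ Set.range (idem (G := G))),
      ∀ x : MonoidAlgebra ℚ G, (∀ H : Subgroup G, x * idem H ∈ (toRat G).range) →
        ∀ H : Subgroup G, x * s * idem H ∈ (toRat G).range := by
    intro s hs
    induction hs using Algebra.adjoin_induction with
    | mem s hs =>
      intro x hx H
      obtain ⟨r, rfl⟩ | ⟨K, rfl⟩ := hs
      · rw [mul_right_comm]
        exact mul_mem (hx H) ⟨r, rfl⟩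
      · rw [mul_assoc, idem_mul_idem]
        exact hx _
    | algebraMap n =>
      intro x hx H
      rw [mul_right_comm]
      exact mul_mem (hx H) ⟨algebraMap _ _ n, by simp⟩
    | add s t _ _ hs ht =>
      intro x hx H
      rw [mul_add, add_mul]
      exact add_mem (hs x hx H) (ht x hx H)
    | mul s t _ _ hs ht =>
      intro x hx H
      rw [← mul_assoc]
      exact ht _ (hs x hx) H
  have := key s (mem_adjoin_idem hp hG hs) x hx ⊥
  rwa [idem_bot, mul_one] at this

end PGroup

/-! ### The normalization as the ring of integral elements of `ℚ[G]` -/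

section Embedding

variable (G : Type*) [CommGroup G]

/-- The identification `ℤ[G] ⊗ ℚ = ℚ[G]`. -/
def tensorRatEquiv : MonoidAlgebra ℤ G ⊗[ℤ] ℚ ≃ₐ[ℤ] MonoidAlgebra ℚ G :=
  (Algebra.TensorProduct.comm ℤ _ _).trans
    ((MonoidAlgebra.scalarTensorEquiv ℤ ℚ).restrictScalars ℤ)

/-- The embedding of the normalization of `ℤ[G]` into `ℚ[G]`. -/
def normToRat : Normalization (MonoidAlgebra ℤ G) →+* MonoidAlgebra ℚ G :=
  (tensorRatEquiv G).toRingEquiv.toRingHom.comp (Normalization.val (MonoidAlgebra ℤ G)).toRingHom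

theorem normToRat_injective : Function.Injective (normToRat G) :=
  (tensorRatEquiv G).injective.comp (Normalization.val_injective _)

@[simp] theorem normToRat_toNormalization (r : MonoidAlgebra ℤ G) :
    normToRat G (toNormalization G r) = toRat G r := by
  change tensorRatEquiv G (r ⊗ₜ 1) = _
  simp only [tensorRatEquiv, AlgEquiv.trans_apply, Algebra.TensorProduct.comm_tmul,
    AlgEquiv.restrictScalars_apply, MonoidAlgebra.scalarTensorEquiv_tmul, one_smul]
  rfl

theorem isIntegral_normToRat [Finite G] (s : Normalization (MonoidAlgebra ℤ G)) :
    IsIntegral ℤ (normToRat G s) := by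
  have : Algebra.IsIntegral ℤ (MonoidAlgebra ℤ G) := ⟨isIntegral_int⟩
  have h1 : IsIntegral (MonoidAlgebra ℤ G) (Normalization.val _ s) :=
    (mem_integralClosure_iff _ _).1 s.2
  have h2 : IsIntegral ℤ (Normalization.val _ s) := isIntegral_trans _ h1
  exact h2.map (tensorRatEquiv G)

theorem exists_normToRat_eq {y : MonoidAlgebra ℚ G} (hy : IsIntegral ℤ y) :
    ∃ s, normToRat G s = y := by
  have h1 : IsIntegral ℤ ((tensorRatEquiv G).symm y) := hy.map (tensorRatEquiv G).symm
  have h2 : IsIntegral (MonoidAlgebra ℤ G) ((tensorRatEquiv G).symm y) := h1.tower_top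
  exact ⟨⟨_, (mem_integralClosure_iff _ _).2 h2⟩, (tensorRatEquiv G).apply_symm_apply y⟩

end Embedding

/-! ### Multiples of norm elements -/

section Norm

variable {G : Type*} [CommGroup G] [Finite G]

theorem exists_eq_norm_mul (P : Subgroup G) {c : MonoidAlgebra ℤ G}
    (hc : ∀ h ∈ P, MonoidAlgebra.single h 1 * c = c) : ∃ y, c = norm P * y := by
  classical
  have := Fintype.ofFinite P
  -- `c` is constant on cosets of `P`, so it suffices to keep its coefficients on one representative
  -- per coset.
  let y : MonoidAlgebra ℤ G := MonoidAlgebra.ofCoeff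
    (Finsupp.equivFunOnFinite.symm fun g => if (QuotientGroup.mk g : G ⧸ P).out = g then
      c.coeff g else 0)
  have hy : ∀ g, y.coeff g = if (QuotientGroup.mk g : G ⧸ P).out = g then c.coeff g else 0 :=
    fun g => rfl
  have hcoeff : ∀ h ∈ P, ∀ g, c.coeff (h⁻¹ * g) = c.coeff g := fun h hh g => by
    conv_rhs => rw [← hc h hh]
    rw [MonoidAlgebra.coeff_single_mul_apply, one_mul]
  refine ⟨y, ?_⟩
  ext g
  rw [norm_eq, Finset.sum_mul, MonoidAlgebra.coeff_sum, Finsupp.finsetSum_apply]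
  simp only [MonoidAlgebra.coeff_single_mul_apply, one_mul]
  set o := (QuotientGroup.mk g : G ⧸ P).out with ho
  have hmem : g * o⁻¹ ∈ P := by
    have : (QuotientGroup.mk o : G ⧸ P) = QuotientGroup.mk g := QuotientGroup.out_eq' _
    rw [QuotientGroup.eq] at this
    rwa [mul_comm]
  rw [Finset.sum_eq_single (⟨g * o⁻¹, hmem⟩ : P)]
  · have h1 : (g * o⁻¹)⁻¹ * g = o := by group
    have h2 : (QuotientGroup.mk o : G ⧸ P).out = o := by rw [ho, QuotientGroup.out_eq']
    rw [hy]
    simp only [h1, if_pos h2]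
    rw [← h1]
    exact (hcoeff _ hmem g).symm
  · intro h _ hne
    rw [hy, if_neg]
    intro h3
    apply hne
    have h4 : (QuotientGroup.mk ((h : G)⁻¹ * g) : G ⧸ P) = QuotientGroup.mk g := by
      rw [QuotientGroup.eq]
      simp
    rw [h4] at h3
    ext
    simp only [ho]
    rw [h3]
    simp
  · simp

theorem exists_mul_idem_eq (P : Subgroup G) {x : MonoidAlgebra ℚ G}
    (hx : x * idem P ∈ (toRat G).range) :
    ∃ y, x * idem P = toRat G (norm P * y) := by
  obtain ⟨c, hc⟩ := hx
  have : ∀ h ∈ P, MonoidAlgebra.single h 1 * c = c := fun h hh => by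
    apply toRat_injective
    rw [map_mul, hc, toRat_single, Int.cast_one, mul_left_comm, single_mul_idem P hh]
  obtain ⟨y, hy⟩ := exists_eq_norm_mul P this
  exact ⟨y, by rw [← hc, ← hy]⟩

theorem norm_mul_norm (H : Subgroup G) :
    norm H * norm H = (Nat.card H : MonoidAlgebra ℤ G) * norm H := by
  apply toRat_injective
  rw [map_mul, map_mul, map_natCast, ← card_mul_idem]
  have h : idem H * idem H = idem H := by rw [idem_mul_idem, sup_idem]
  linear_combination (Nat.card H : MonoidAlgebra ℚ G) ^ 2 * h

theorem norm_pow (H : Subgroup G) (n : ℕ) :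
    norm H ^ (n + 1) = (Nat.card H : MonoidAlgebra ℤ G) ^ n * norm H := by
  induction n with
  | zero => simp
  | succ n ih => rw [pow_succ, ih, mul_assoc, norm_mul_norm]; ring

end Norm

/-! ### The reduced conductor is a `λ`-ideal -/

section LambdaIdeal

variable {G : Type*} [CommGroup G]

theorem toRat_theta {l : ℕ} (hl : l.Prime) (x : MonoidAlgebra ℤ G) :
    (l : MonoidAlgebra ℚ G) * toRat G (theta hl x) = toRat G x ^ l - toRat G (adams G l x) := by
  rw [← map_natCast (toRat G), ← map_mul, theta_spec, map_sub, map_pow]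

variable [Finite G]

theorem exists_pow_pow_eq {l : ℕ} (hl : l.Coprime (Nat.card G)) :
    ∃ m : ℕ, ∀ g : G, (g ^ m) ^ l = g := by
  -- By Euler's theorem this exponent inverts `l` modulo `|G|`.
  refine ⟨l ^ (Nat.totient (Nat.card G) - 1), fun g => ?_⟩
  rw [← pow_mul, ← pow_succ, Nat.sub_add_cancel (Nat.totient_pos.2 Nat.card_pos)]
  conv_rhs => rw [← pow_one g]
  exact pow_eq_pow_iff_modEq.2 ((Nat.ModEq.pow_totient hl).of_dvd (orderOf_dvd_natCard g))

theorem exists_adamsRat_eq {l : ℕ} (hl : l.Coprime (Nat.card G)) {s : MonoidAlgebra ℚ G}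
    (hs : IsIntegral ℤ s) : ∃ t, IsIntegral ℤ t ∧ adamsRat G l t = s := by
  obtain ⟨m, hm⟩ := exists_pow_pow_eq hl
  refine ⟨adamsRat G m s, hs.map (adamsRat G m).toIntAlgHom, ?_⟩
  clear hs
  induction s using MonoidAlgebra.induction_linear with
  | zero => simp
  | add x y hx hy => rw [map_add, map_add, hx, hy]
  | single g c => rw [adamsRat_single, adamsRat_single, hm]

/-- The preimage modulo `H` is the `p`-torsion of `G ⧸ H`, which is nontrivial by Cauchy's theorem.
-/
theorem card_dvd_card_of_comap_pow {p e : ℕ} (hp : p.Prime) (hG : Nat.card G = p ^ e)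
    {H : Subgroup G} (hH : H ≠ ⊤) :
    p * Nat.card H ∣ Nat.card (H.comap (powMonoidHom p : G →* G)) := by
  have : Fact p.Prime := ⟨hp⟩
  have hle : H ≤ H.comap (powMonoidHom p : G →* G) := fun g hg => pow_mem hg p
  obtain ⟨m, hm⟩ := Subgroup.card_dvd_of_le hle
  have hmp : m ∣ p ^ e := by
    rw [← hG]
    exact (Dvd.intro_left _ hm.symm).trans (Subgroup.card_subgroup_dvd_card _)
  obtain ⟨k, -, rfl⟩ := (Nat.dvd_prime_pow hp).1 hmp
  obtain _ | k := k
  · exfalso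
    rw [pow_zero, mul_one] at hm
    have heq := Subgroup.eq_of_le_of_card_ge hle hm.le
    have hdvd : p ∣ Nat.card (G ⧸ H) := by
      have h1 : Nat.card (G ⧸ H) ∣ p ^ e := hG ▸ Subgroup.card_quotient_dvd_card H
      obtain ⟨k, -, hk⟩ := (Nat.dvd_prime_pow hp).1 h1
      obtain _ | k := k
      · exact absurd (Subgroup.index_eq_one.1 (by rw [Subgroup.index, hk, pow_zero])) hH
      · rw [hk, pow_succ]
        exact dvd_mul_left _ _
    obtain ⟨x, hx⟩ := exists_prime_orderOf_dvd_card' p hdvd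
    obtain ⟨g, rfl⟩ := QuotientGroup.mk_surjective x
    have h1 : g ∈ H.comap (powMonoidHom p : G →* G) := by
      rw [Subgroup.mem_comap, powMonoidHom_apply, ← QuotientGroup.eq_one_iff,
        QuotientGroup.mk_pow, ← hx, pow_orderOf_eq_one]
    rw [← heq, ← QuotientGroup.eq_one_iff] at h1
    rw [h1, orderOf_one] at hx
    exact hp.one_lt.ne hx
  · rw [hm, pow_succ, mul_comm p, ← mul_assoc, mul_right_comm]
    exact dvd_mul_right _ _

/-- `x` lies in the conductor of the integral closure into `ℤ[G]`. -/
def InConductor (x : MonoidAlgebra ℤ G) : Prop :=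
  ∀ s, IsIntegral ℤ s → toRat G x * s ∈ (toRat G).range

/-- With `P` the preimage of `H` under the `p`-th power map, `x * idem P` is a multiple of `norm P =
|P| idem P`. Applying `ψ^p` and multiplying by `idem H` gives a multiple of `|P| idem H`, and `p
|H|` divides `|P|`. -/
theorem InConductor.adams_mul_idem {p e : ℕ} (hp : p.Prime) (hG : Nat.card G = p ^ e)
    {x : MonoidAlgebra ℤ G} (hx : InConductor x) {H : Subgroup G} (hH : H ≠ ⊤) :
    ∃ b, toRat G (adams G p x) * idem H = p * toRat G b := by
  set P := H.comap (powMonoidHom p : G →* G) with hP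
  obtain ⟨y, hy⟩ := exists_mul_idem_eq P (hx _ (isIntegral_idem P))
  -- `ψ^p` maps `P` into `H`, and `idem H` absorbs the elements of `H`.
  have h1 : adamsRat G p (idem P) * idem H = idem H := by
    refine ext_ev fun χ => ?_
    rw [map_mul, ev_adamsRat, ev_idem, ev_idem]
    split_ifs with h2 h3 h3
    · simp
    · simp
    · refine absurd (fun g hg => ?_) h2
      rw [MonoidHom.mem_ker, MonoidHom.pow_apply, ← map_pow]
      exact h3 hg
    · simp
  obtain ⟨m, hm⟩ := card_dvd_card_of_comap_pow hp hG hH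
  refine ⟨(m : MonoidAlgebra ℤ G) * norm H * adams G p y, ?_⟩
  have h2 : toRat G (adams G p x) * idem H = adamsRat G p (toRat G x * idem P) * idem H := by
    rw [map_mul, toRat_adams, mul_assoc, h1]
  rw [← hP] at hm
  have h3 : (Nat.card P : MonoidAlgebra ℚ G) = p * Nat.card H * m := by
    rw [hm]
    push_cast
    ring
  rw [h2, hy]
  simp only [map_mul, ← card_mul_idem, map_natCast, toRat_adams]
  linear_combination
    (adamsRat G p (idem P) * adamsRat G p (toRat G y) * idem H) * h3 +
    (p * (Nat.card H) * m * adamsRat G p (toRat G y) : MonoidAlgebra ℚ G) * h1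

theorem InConductor.pow_mul_idem {p e : ℕ} (hp : p.Prime) (hG : Nat.card G = p ^ e)
    {x : MonoidAlgebra ℤ G} (hx : InConductor x) {H : Subgroup G} (hH : H ≠ ⊥) :
    ∃ b, toRat G x ^ p * idem H = p * toRat G b := by
  obtain ⟨y, hy⟩ := exists_mul_idem_eq H (hx _ (isIntegral_idem H))
  have hi : IsIdempotentElem (idem H) := by rw [IsIdempotentElem, idem_mul_idem, sup_idem]
  have hdvd : p ∣ Nat.card H := by
    obtain ⟨k, -, hk⟩ := (Nat.dvd_prime_pow hp).1 (hG ▸ Subgroup.card_subgroup_dvd_card H)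
    obtain _ | k := k
    · exact absurd (Subgroup.eq_bot_of_card_eq H (by rw [hk, pow_zero])) hH
    · rw [hk, pow_succ]
      exact dvd_mul_left _ _
  obtain ⟨m, hm⟩ := hdvd
  -- In `norm H ^ p = |H| ^ (p - 1) * norm H` one factor `|H|` is split off to supply the `p`; this
  -- needs `p ≥ 2`.
  obtain ⟨n, hn⟩ : ∃ n, p = n + 1 + 1 := ⟨p - 2, by have := hp.two_le; omega⟩
  have h1 : toRat G x ^ p * idem H = (toRat G x * idem H) ^ p := by
    rw [mul_pow, hn, hi.pow_succ_eq]
  have h2 : norm H ^ p = (Nat.card H : MonoidAlgebra ℤ G) ^ n * Nat.card H * norm H := by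
    rw [hn, norm_pow, pow_succ]
  have hm' : (Nat.card H : MonoidAlgebra ℤ G) = p * m := by
    rw [hm, Nat.cast_mul]
  refine ⟨(Nat.card H : MonoidAlgebra ℤ G) ^ n * m * norm H * y ^ p, ?_⟩
  rw [h1, hy, ← map_pow, mul_pow, h2, ← map_natCast (toRat G) p, ← map_mul]
  congr 1
  linear_combination ((Nat.card H : MonoidAlgebra ℤ G) ^ n * norm H * y ^ p) * hm'

/-- Being killed by the norm means vanishing at the trivial character, which `ψ^l` fixes. -/
theorem theta_mul_norm_top {l : ℕ} (hl : l.Prime) {x : MonoidAlgebra ℤ G} (hx : x * norm ⊤ = 0) :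
    theta hl x * norm ⊤ = 0 := by
  have hcard : (Nat.card (⊤ : Subgroup G) : ℂ) ≠ 0 := by exact_mod_cast Nat.card_pos.ne'
  have hker : (⊤ : Subgroup G) ≤ (1 : G →* ℂˣ).ker := fun g _ => rfl
  have hone : (1 : G →* ℂˣ) ^ l = 1 := MonoidHom.ext fun g => by simp
  have h1 : ev 1 (toRat G x) = 0 := by
    have := congrArg (fun z => ev 1 (toRat G z)) hx
    rw [map_mul, map_mul, ev_norm, if_pos hker, map_zero, map_zero] at this
    exact (mul_eq_zero.1 this).resolve_right hcard
  have h2 : ev 1 (toRat G (theta hl x)) = 0 := by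
    have := congrArg (ev 1) (toRat_theta hl x)
    rw [map_mul, map_sub, map_pow, toRat_adams, ev_adamsRat, hone, h1, map_natCast,
      zero_pow hl.ne_zero, sub_zero] at this
    exact (mul_eq_zero.1 this).resolve_left (by exact_mod_cast hl.ne_zero)
  apply toRat_injective
  refine ext_ev fun χ => ?_
  rw [map_mul, map_mul, ev_norm, map_zero, map_zero]
  split_ifs with h
  · have : χ = 1 := MonoidHom.ext fun g => h (Subgroup.mem_top g)
    rw [this, h2, zero_mul]
  · rw [mul_zero]

/-- For `l = p` the idempotents are tested one by one, and only `H = ⊤` needs the norm condition.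
For `l ≠ p` both `l θ(x) s` and `|G| θ(x) s` are in `ℤ[G]`, and `l` is prime to `|G|`. -/
theorem InConductor.theta {p e : ℕ} (hp : p.Prime) (hG : Nat.card G = p ^ e) {l : ℕ}
    (hl : l.Prime) {x : MonoidAlgebra ℤ G} (hx : InConductor x)
    (hx0 : Nontrivial G → x * norm ⊤ = 0) : InConductor (theta hl x) := by
  by_cases htriv : Nontrivial G
  swap
  · intro s hs
    have h1 : Nat.card G = 1 := by
      rw [not_nontrivial_iff_subsingleton] at htriv
      exact Nat.card_unique
    have := card_mul_mem_range_toRat hs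
    rw [h1, Nat.cast_one, one_mul] at this
    exact mul_mem ⟨_, rfl⟩ this
  by_cases hlp : l = p
  · subst hlp
    refine fun s hs => mul_mem_range_of_forall_idem hp hG (fun H => ?_) hs
    by_cases hbot : H = ⊥
    · rw [hbot, idem_bot, mul_one]
      exact ⟨_, rfl⟩
    by_cases htop : H = ⊤
    · refine ⟨0, ?_⟩
      apply natCast_mul_cancel_rat (n := Nat.card H) Nat.card_pos.ne'
      rw [mul_left_comm, card_mul_idem, map_zero, mul_zero, ← map_mul, htop,
        theta_mul_norm_top hl (hx0 htriv), map_zero]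
    obtain ⟨a, ha⟩ := hx.pow_mul_idem hp hG hbot
    obtain ⟨b, hb⟩ := hx.adams_mul_idem hp hG htop
    refine ⟨a - b, ?_⟩
    apply natCast_mul_cancel_rat hl.ne_zero
    rw [← mul_assoc, toRat_theta, sub_mul, ha, hb, map_sub, mul_sub]
  · intro s hs
    have hcop : l.Coprime (Nat.card G) := by
      rw [hG]
      exact Nat.Coprime.pow_right _ ((Nat.coprime_primes hl hp).2 hlp)
    -- Writing `s = ψ^l(t)` turns `ψ^l(x) s` into `ψ^l(x t)`, where the conductor hypothesis
    -- applies.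
    obtain ⟨t, ht, rfl⟩ := exists_adamsRat_eq hcop hs
    obtain ⟨c, hc⟩ := hx t ht
    obtain ⟨d, hd⟩ := hx _ (((isIntegral_toRat x).pow (l - 1)).mul hs)
    have hpow : toRat G x ^ l = toRat G x * toRat G x ^ (l - 1) := by
      rw [← pow_succ', Nat.sub_add_cancel hl.one_le]
    obtain ⟨r, hr⟩ := card_mul_mem_range_toRat hs
    have h1 : (l : MonoidAlgebra ℚ G) * (toRat G (GroupRing.theta hl x) * adamsRat G l t)
        = toRat G (d - adams G l c) := by
      rw [← mul_assoc, toRat_theta, sub_mul, map_sub, hd, hpow, toRat_adams, toRat_adams, hc,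
        map_mul]
      ring
    have h2 : (Nat.card G : MonoidAlgebra ℚ G) * (toRat G (GroupRing.theta hl x) * adamsRat G l t)
        = toRat G (GroupRing.theta hl x * r) := by
      rw [map_mul, hr]; ring
    have hb := Nat.isCoprime_iff_coprime.2 hcop
    obtain ⟨u, v, huv⟩ := hb
    refine ⟨(u : MonoidAlgebra ℤ G) * (d - adams G l c) +
      (v : MonoidAlgebra ℤ G) * (GroupRing.theta hl x * r), ?_⟩
    have huv' : (u * l + v * Nat.card G : MonoidAlgebra ℚ G) = 1 := by
      exact_mod_cast congrArg (Int.cast : ℤ → MonoidAlgebra ℚ G) huv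
    rw [map_add, map_mul, map_mul (toRat G) (v : MonoidAlgebra ℤ G), ← h1, ← h2, map_intCast,
      map_intCast]
    linear_combination (toRat G (GroupRing.theta hl x) * adamsRat G l t) * huv'

variable (G) in
/-- The ideal of the normalization of `ℤ[G]` cut out of the conductor by the trivial character if
`G` is nontrivial. -/
def reducedConductor : Ideal (Normalization (MonoidAlgebra ℤ G)) where
  carrier := {s | (∀ t, s * t ∈ (toNormalization G).range) ∧
    (Nontrivial G → s * toNormalization G (norm ⊤) = 0)}
  zero_mem' := ⟨fun t => by simp, fun _ => by simp⟩
  add_mem' := fun ha hb => ⟨fun t => by rw [add_mul]; exact add_mem (ha.1 t) (hb.1 t),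
    fun h => by rw [add_mul, ha.2 h, hb.2 h, add_zero]⟩
  smul_mem' := fun c a ha => ⟨fun t => by
      rw [smul_eq_mul, mul_comm c a, mul_assoc]; exact ha.1 _,
    fun h => by rw [smul_eq_mul, mul_assoc, ha.2 h, mul_zero]⟩

theorem isLambdaIdeal_reducedConductor {p e : ℕ} (hp : p.Prime) (hG : Nat.card G = p ^ e) :
    IsLambdaIdeal (toNormalization G) (reducedConductor G) := by
  refine ⟨fun x hx => ?_, fun l hl a ha => ?_⟩
  · have := hx.1 1
    rw [mul_one] at this
    exact this
  · have h0 : Nontrivial G → a * norm ⊤ = 0 := fun h => by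
      apply toNormalization_injective G
      rw [map_mul, ha.2 h, map_zero]
    have h1 : InConductor a := fun s hs => by
      obtain ⟨t, rfl⟩ := exists_normToRat_eq G hs
      obtain ⟨c, hc⟩ := ha.1 t
      exact ⟨c, by rw [← normToRat_toNormalization, hc, map_mul, normToRat_toNormalization]⟩
    have h2 := h1.theta hp hG hl h0
    refine ⟨fun t => ?_, fun h => ?_⟩
    · obtain ⟨c, hc⟩ := h2 _ (isIntegral_normToRat G t)
      refine ⟨c, normToRat_injective G ?_⟩
      rw [map_mul, normToRat_toNormalization, normToRat_toNormalization, hc]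
    · rw [← map_mul, theta_mul_norm_top hl (h0 h), map_zero]

end LambdaIdeal

/-! ### Norm elements annihilate `λ`-ideals -/

section Descent

theorem natCast_dvd_iff {G : Type*} [CommGroup G] {n : ℕ} {x : MonoidAlgebra ℤ G} :
    (n : MonoidAlgebra ℤ G) ∣ x ↔ ∀ g, (n : ℤ) ∣ x.coeff g := by
  constructor
  · rintro ⟨y, rfl⟩ g
    rw [← nsmul_eq_mul, MonoidAlgebra.coeff_smul, Finsupp.smul_apply, nsmul_eq_mul]
    exact dvd_mul_right _ _
  · intro h
    have h2 : x = x.coeff.sum MonoidAlgebra.single := (MonoidAlgebra.sum_coeff_single x).symm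
    rw [h2]
    refine Finset.dvd_sum fun g _ => ?_
    obtain ⟨c, hc⟩ := h g
    refine ⟨MonoidAlgebra.single g c, ?_⟩
    rw [hc, ← nsmul_eq_mul (n : ℕ) (MonoidAlgebra.single g c), MonoidAlgebra.smul_single,
      nsmul_eq_mul]

theorem eq_zero_of_forall_pow_dvd {G : Type*} [CommGroup G] {p : ℕ} (hp : p.Prime)
    {x : MonoidAlgebra ℤ G} (h : ∀ n : ℕ, (p : MonoidAlgebra ℤ G) ^ n ∣ x) : x = 0 := by
  ext g
  rw [MonoidAlgebra.coeff_zero, Finsupp.zero_apply]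
  by_contra h0
  have h1 : FiniteMultiplicity (p : ℤ) (x.coeff g) :=
    Int.finiteMultiplicity_iff.2 ⟨by simpa using hp.ne_one, h0⟩
  obtain ⟨n, hn⟩ := h1
  apply hn
  have h2 := h (n + 1)
  rw [← Nat.cast_pow, natCast_dvd_iff] at h2
  exact_mod_cast h2 g

theorem natCast_mul_cancel' {G : Type*} [CommGroup G] {n : ℕ} (hn : n ≠ 0)
    {a b : MonoidAlgebra ℤ G} (h : (n : MonoidAlgebra ℤ G) * a = n * b) : a = b := by
  apply toRat_injective
  apply natCast_mul_cancel_rat hn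
  rw [← map_natCast (toRat G), ← map_mul, h, map_mul]

theorem theta_mapDomain {A B : Type*} [CommGroup A] [CommGroup B] (E : A →* B) {l : ℕ}
    (hl : l.Prime) (a : MonoidAlgebra ℤ A) :
    theta hl (MonoidAlgebra.mapDomainRingHom ℤ E a) =
      MonoidAlgebra.mapDomainRingHom ℤ E (theta hl a) := by
  have h : ∀ a, MonoidAlgebra.mapDomainRingHom ℤ E (adams A l a) =
      adams B l (MonoidAlgebra.mapDomainRingHom ℤ E a) := fun a => by
    induction a using MonoidAlgebra.induction_linear with
    | zero => simp
    | add x y hx hy => simp only [map_add, hx, hy]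
    | single g c => simp [adams_single]
  apply theta_unique
  rw [← map_natCast (MonoidAlgebra.mapDomainRingHom ℤ E), ← map_mul, theta_spec, map_sub, map_pow, h]

theorem adams_mapDomain {A B : Type*} [CommGroup A] [CommGroup B] (E : A →* B) (n : ℕ)
    (a : MonoidAlgebra ℤ A) :
    adams B n (MonoidAlgebra.mapDomainRingHom ℤ E a) =
      MonoidAlgebra.mapDomainRingHom ℤ E (adams A n a) := by
  induction a using MonoidAlgebra.induction_linear with
  | zero => simp
  | add x y hx hy => simp only [map_add, hx, hy]
  | single g c => simp [adams_single]

theorem IsLambdaIdeal.comp_mulEquiv {A B S : Type*} [CommGroup A] [CommGroup B] [CommRing S]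
    {f : MonoidAlgebra ℤ B →+* S} {I : Ideal S} (h : IsLambdaIdeal f I) (E : A ≃* B) :
    IsLambdaIdeal (f.comp (MonoidAlgebra.mapDomainRingHom ℤ E.toMonoidHom)) I := by
  have hE : ∀ b : MonoidAlgebra ℤ B, MonoidAlgebra.mapDomainRingHom ℤ E.toMonoidHom
      (MonoidAlgebra.mapDomainRingHom ℤ E.symm.toMonoidHom b) = b := fun b => by
    induction b using MonoidAlgebra.induction_linear with
    | zero => simp
    | add x y hx hy => simp only [map_add, hx, hy]
    | single g c => simp
  refine ⟨fun x hx => ?_, fun l hl a ha => ?_⟩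
  · obtain ⟨b, rfl⟩ := h.1 x hx
    exact ⟨MonoidAlgebra.mapDomainRingHom ℤ E.symm.toMonoidHom b,
      by rw [RingHom.comp_apply, hE]⟩
  · rw [RingHom.comp_apply, ← theta_mapDomain]
    exact h.2 l hl _ ha

variable {A B : Type*} [CommGroup A] [CommGroup B]

/-- The inclusion `ℤ[A] → ℤ[A × B]`. -/
def inlRing (A B : Type*) [CommGroup A] [CommGroup B] :
    MonoidAlgebra ℤ A →+* MonoidAlgebra ℤ (A × B) :=
  MonoidAlgebra.mapDomainRingHom ℤ (MonoidHom.inl A B)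

/-- The inclusion `ℤ[B] → ℤ[A × B]`. -/
def inrRing (A B : Type*) [CommGroup A] [CommGroup B] :
    MonoidAlgebra ℤ B →+* MonoidAlgebra ℤ (A × B) :=
  MonoidAlgebra.mapDomainRingHom ℤ (MonoidHom.inr A B)

/-- The projection `ℤ[A × B] → ℤ[B]`. -/
def sndRing (A B : Type*) [CommGroup A] [CommGroup B] :
    MonoidAlgebra ℤ (A × B) →+* MonoidAlgebra ℤ B :=
  MonoidAlgebra.mapDomainRingHom ℤ (MonoidHom.snd A B)

variable [Finite A]

theorem norm_mul_single {P : Subgroup A} {h : A} (hh : h ∈ P) :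
    norm P * MonoidAlgebra.single h 1 = norm P := by
  apply toRat_injective
  rw [map_mul, ← card_mul_idem, toRat_single, Int.cast_one, mul_assoc, mul_comm (idem P),
    single_mul_idem P hh]

theorem norm_mul_adams (n : ℕ) :
    norm (⊤ : Subgroup A) * adams A n (norm ⊤) = Nat.card A * norm (⊤ : Subgroup A) := by
  have := Fintype.ofFinite (⊤ : Subgroup A)
  conv_lhs => rw [norm_eq ⊤, map_sum, ← norm_eq, Finset.mul_sum]
  simp only [adams_single, norm_mul_single (Subgroup.mem_top _)]
  rw [Finset.sum_const, nsmul_eq_mul, Finset.card_univ, ← Nat.card_eq_fintype_card,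
    Subgroup.card_top]

theorem inlRing_norm_mul (c : MonoidAlgebra ℤ (A × B)) :
    inlRing A B (norm ⊤) * c = inlRing A B (norm ⊤) * inrRing A B (sndRing A B c) := by
  induction c using MonoidAlgebra.induction_linear with
  | zero => simp
  | add x y hx hy => rw [mul_add, hx, hy, map_add, map_add, mul_add]
  | single g c =>
    have h1 : MonoidAlgebra.single g c = inlRing A B (MonoidAlgebra.single g.1 1) *
        inrRing A B (sndRing A B (MonoidAlgebra.single g c)) := by
      simp [inlRing, inrRing, sndRing, MonoidAlgebra.single_mul_single]
    conv_lhs => rw [h1]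
    rw [← mul_assoc, ← map_mul, norm_mul_single (Subgroup.mem_top _)]

/-- Multiplication by the norm of `A` copies `y` onto every slice `{a} × B`; reading off one slice
gives injectivity and divisibility statements. -/
theorem coeff_norm_mul (y : MonoidAlgebra ℤ B) (b : B) :
    (inlRing A B (norm ⊤) * inrRing A B y).coeff (1, b) = y.coeff b := by
  classical
  have := Fintype.ofFinite (⊤ : Subgroup A)
  induction y using MonoidAlgebra.induction_linear with
  | zero => simp
  | add x y hx hy =>
    rw [map_add, mul_add, MonoidAlgebra.coeff_add, Finsupp.add_apply, hx, hy]; simp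
  | single b' c =>
    rw [norm_eq, map_sum, Finset.sum_mul, MonoidAlgebra.coeff_sum, Finsupp.finsetSum_apply,
      Finset.sum_eq_single (1 : (⊤ : Subgroup A))]
    · simp [inlRing, inrRing, MonoidAlgebra.single_mul_single, Finsupp.single_apply]
    · intro a _ ha
      have : (a : A) ≠ 1 := fun h => ha (Subtype.ext h)
      simp [inlRing, inrRing, MonoidAlgebra.single_mul_single, this]
    · simp

theorem norm_mul_injective {y z : MonoidAlgebra ℤ B}
    (h : inlRing A B (norm ⊤) * inrRing A B y = inlRing A B (norm ⊤) * inrRing A B z) : y = z := by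
  ext b
  rw [← coeff_norm_mul (A := A) y b, h, coeff_norm_mul]

variable {S : Type*} [CommRing S]

/-- Here `ε` plays the role of the idempotent `N / |A|`. Since `ε * F a` stays in the ideal, it
comes from `ℤ[A × B]`, which forces `|A|` to divide the projection of `a`. -/
theorem exists_norm_mul_mem {F : MonoidAlgebra ℤ (A × B) →+* S} (hF : Function.Injective F)
    {ε : S} (hε : (Nat.card A : S) * ε = F (inlRing A B (norm ⊤))) {I : Ideal S}
    (hI : IsLambdaIdeal F I) {a : MonoidAlgebra ℤ (A × B)} (ha : F a ∈ I) :
    ∃ w, F (inlRing A B (norm ⊤) * inrRing A B w) ∈ I ∧ sndRing A B a = Nat.card A * w := by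
  have hA : Nat.card A ≠ 0 := Nat.card_pos.ne'
  obtain ⟨c, hc⟩ := hI.1 (ε * F a) (I.mul_mem_left _ ha)
  have h1 : (Nat.card A : MonoidAlgebra ℤ (A × B)) * c =
      inlRing A B (norm ⊤) * inrRing A B (sndRing A B a) := by
    rw [← inlRing_norm_mul]
    apply hF
    rw [map_mul, hc, map_mul, map_natCast, ← mul_assoc, hε]
  have h2 : (Nat.card A : MonoidAlgebra ℤ B) ∣ sndRing A B a := by
    rw [natCast_dvd_iff]
    intro b
    rw [← coeff_norm_mul (A := A), ← h1]
    exact natCast_dvd_iff.1 (dvd_mul_right _ _) _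
  obtain ⟨w, hw⟩ := h2
  refine ⟨w, ?_, hw⟩
  have h3 : c = inlRing A B (norm ⊤) * inrRing A B w := by
    apply natCast_mul_cancel' hA
    rw [h1, hw, map_mul, map_natCast]
    ring
  rw [← h3, hc]
  exact I.mul_mem_left _ ha

/-- Infinite descent on the set of `z ∈ ℤ[B]` with `N z` in the ideal. Each such `z` has a companion
`w` in the set with `ψ^p z = |A|^(p-1) z^p - p w`. If `p^n` divides the whole set, then `p^(n+1)`
divides `ψ^p z`, and so `z`, because `ψ^p` is invertible on `ℤ[B]`. -/
theorem norm_mul_eq_zero_of_isLambdaIdeal [Finite B] {p e : ℕ} (hp : p.Prime)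
    (hA : Nat.card A = p ^ (e + 1)) (hB : p.Coprime (Nat.card B))
    {F : MonoidAlgebra ℤ (A × B) →+* S} (hF : Function.Injective F)
    {ε : S} (hε : (Nat.card A : S) * ε = F (inlRing A B (norm ⊤))) {I : Ideal S}
    (hI : IsLambdaIdeal F I) {x : S} (hx : x ∈ I) : F (inlRing A B (norm ⊤)) * x = 0 := by
  have hA0 : Nat.card A ≠ 0 := Nat.card_pos.ne'
  set N := inlRing A B (norm ⊤) with hN
  -- `w` is the projection of `θ^p(N z)` to `ℤ[B]` divided by `|A|`.
  have step : ∀ z, F (N * inrRing A B z) ∈ I → ∃ w, F (N * inrRing A B w) ∈ I ∧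
      (p : MonoidAlgebra ℤ B) * w = (Nat.card A : MonoidAlgebra ℤ B) ^ (p - 1) * z ^ p
        - adams B p z := by
    intro z hz
    obtain ⟨w, hw, hw'⟩ := exists_norm_mul_mem hF hε hI (hI.2 p hp _ hz)
    refine ⟨w, hw, ?_⟩
    have h1 : N * (p * theta hp (N * inrRing A B z)) =
        (Nat.card A : MonoidAlgebra ℤ (A × B)) * (N * inrRing A B (p * w)) := by
      rw [mul_left_comm, hN, inlRing_norm_mul, hw', ← hN, map_mul, map_mul, map_natCast,
        map_natCast]
      ring
    have hNp : N * N ^ p = (Nat.card A : MonoidAlgebra ℤ (A × B)) * (Nat.card A) ^ (p - 1) * N := by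
      rw [← pow_succ', hN, ← map_pow, norm_pow, Subgroup.card_top, map_mul, map_pow, map_natCast,
        ← pow_succ', Nat.sub_add_cancel hp.one_le]
    have hNad : N * adams (A × B) p N = (Nat.card A : MonoidAlgebra ℤ (A × B)) * N := by
      rw [hN, inlRing, adams_mapDomain, ← map_mul, norm_mul_adams, map_mul, map_natCast]
    have had : adams (A × B) p (inrRing A B z) = inrRing A B (adams B p z) :=
      adams_mapDomain _ _ _
    rw [theta_spec, mul_pow, map_mul, had] at h1
    apply norm_mul_injective (A := A)
    rw [← hN]
    apply natCast_mul_cancel' hA0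
    rw [← h1, map_sub, map_mul, map_pow, map_natCast, map_pow]
    linear_combination inrRing A B z ^ p * hNp - inrRing A B (adams B p z) * hNad
  obtain ⟨m, hm⟩ := exists_pow_pow_eq (G := B) hB
  have hψ : ∀ z, adams B m (adams B p z) = z := fun z => by
    induction z using MonoidAlgebra.induction_linear with
    | zero => simp
    | add x y hx hy => simp only [map_add, hx, hy]
    | single g c => rw [adams_single, adams_single, ← pow_mul, mul_comm, pow_mul, hm]
  have key : ∀ n : ℕ, ∀ z, F (N * inrRing A B z) ∈ I → (p : MonoidAlgebra ℤ B) ^ n ∣ z := by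
    intro n
    induction n with
    | zero => intro z _; simp
    | succ n ih =>
      intro z hz
      obtain ⟨w, hw, hwz⟩ := step z hz
      have h1 : (p : MonoidAlgebra ℤ B) ∣ (Nat.card A : MonoidAlgebra ℤ B) ^ (p - 1) := by
        have : 0 < p - 1 := Nat.sub_pos_of_lt hp.one_lt
        rw [hA, Nat.cast_pow, ← pow_mul]
        exact dvd_pow_self _ (by positivity)
      have h2 : (p : MonoidAlgebra ℤ B) ^ (n + 1) ∣ adams B p z := by
        have : adams B p z = (Nat.card A : MonoidAlgebra ℤ B) ^ (p - 1) * z ^ p - p * w := by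
          rw [hwz]; ring
        rw [this, pow_succ']
        exact dvd_sub (mul_dvd_mul h1 ((ih z hz).trans (dvd_pow_self _ hp.ne_zero)))
          (mul_dvd_mul_left _ (ih w hw))
      have h3 := map_dvd (adams B m) h2
      rwa [hψ, map_pow, map_natCast] at h3
  obtain ⟨a, rfl⟩ := hI.1 x hx
  obtain ⟨w, hw, hw'⟩ := exists_norm_mul_mem hF hε hI hx
  have hw0 : w = 0 := eq_zero_of_forall_pow_dvd hp fun n => key n w hw
  rw [← map_mul, hN, inlRing_norm_mul, hw', hw0, mul_zero, map_zero, mul_zero, map_zero]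

end Descent

/-! ### The embedding of `S₁ ⊗ S₂` into `ℚ[G₁ × G₂]` -/

theorem eq_zero_of_nsmul_tensorProduct (R M N : Type*) [CommRing R] [IsDomain R] [CharZero R]
    [AddCommGroup M] [AddCommGroup N] [Module R M] [Module R N] [Module.Flat R M]
    [Module.Flat R N] {n : ℕ} (hn : n ≠ 0) {x : M ⊗[R] N} (hx : n • x = 0) : x = 0 := by
  have : Module.Flat R (M ⊗[R] N) := inferInstance
  have : Module.IsTorsionFree R (M ⊗[R] N) := Module.Flat.isTorsionFree
  rw [← Nat.cast_smul_eq_nsmul R] at hx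
  exact (smul_eq_zero.1 hx).resolve_left (Nat.cast_ne_zero.2 hn)

section TensorNormalization

variable (G₁ G₂ : Type*) [CommGroup G₁] [CommGroup G₂]

theorem toTensorNormalization_mul (a : MonoidAlgebra ℤ G₁) (b : MonoidAlgebra ℤ G₂) :
    toTensorNormalization G₁ G₂ (inlRing G₁ G₂ a * inrRing G₁ G₂ b) =
      toNormalization G₁ a ⊗ₜ toNormalization G₂ b := by
  have ha : prodEquivTensor G₁ G₂ (inlRing G₁ G₂ a) = a ⊗ₜ 1 := by
    induction a using MonoidAlgebra.induction_linear with
    | zero => simp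
    | add x y hx hy => rw [map_add, map_add, hx, hy, TensorProduct.add_tmul]
    | single g c =>
      simp [prodEquivTensor, inlRing, TensorProduct.smul_tmul', MonoidAlgebra.one_def]
  have hb : prodEquivTensor G₁ G₂ (inrRing G₁ G₂ b) = 1 ⊗ₜ b := by
    induction b using MonoidAlgebra.induction_linear with
    | zero => simp
    | add x y hx hy => rw [map_add, map_add, hx, hy, TensorProduct.tmul_add]
    | single g c =>
      simp [prodEquivTensor, inrRing, ← TensorProduct.tmul_smul, MonoidAlgebra.one_def]
  have h : prodEquivTensor G₁ G₂ (inlRing G₁ G₂ a * inrRing G₁ G₂ b) = a ⊗ₜ b := by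
    rw [map_mul, ha, hb, Algebra.TensorProduct.tmul_mul_tmul, mul_one, one_mul]
  change Algebra.TensorProduct.map _ _ (prodEquivTensor G₁ G₂ _) = _
  rw [h]
  rfl

theorem toTensorNormalization_inl (a : MonoidAlgebra ℤ G₁) :
    toTensorNormalization G₁ G₂ (inlRing G₁ G₂ a) = toNormalization G₁ a ⊗ₜ 1 := by
  have := toTensorNormalization_mul G₁ G₂ a 1
  rwa [map_one, mul_one, map_one] at this

theorem toTensorNormalization_inr (b : MonoidAlgebra ℤ G₂) :
    toTensorNormalization G₁ G₂ (inrRing G₁ G₂ b) = 1 ⊗ₜ toNormalization G₂ b := by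
  have := toTensorNormalization_mul G₁ G₂ 1 b
  rwa [map_one, one_mul, map_one] at this

/-- The embedding of `S₁ ⊗ S₂` into `ℚ[G₁ × G₂]`. -/
def tensorToRat : Normalization (MonoidAlgebra ℤ G₁) ⊗[ℤ] Normalization (MonoidAlgebra ℤ G₂) →+*
    MonoidAlgebra ℚ (G₁ × G₂) :=
  (Algebra.TensorProduct.productMap
    (((MonoidAlgebra.mapDomainRingHom ℚ (MonoidHom.inl G₁ G₂)).comp (normToRat G₁)).toIntAlgHom)
    (((MonoidAlgebra.mapDomainRingHom ℚ (MonoidHom.inr G₁ G₂)).comp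
      (normToRat G₂)).toIntAlgHom)).toRingHom

theorem tensorToRat_tmul (s : Normalization (MonoidAlgebra ℤ G₁))
    (t : Normalization (MonoidAlgebra ℤ G₂)) :
    tensorToRat G₁ G₂ (s ⊗ₜ t) =
      MonoidAlgebra.mapDomainRingHom ℚ (MonoidHom.inl G₁ G₂) (normToRat G₁ s) *
      MonoidAlgebra.mapDomainRingHom ℚ (MonoidHom.inr G₁ G₂) (normToRat G₂ t) :=
  Algebra.TensorProduct.productMap_apply_tmul _ _ s t

theorem tensorToRat_toTensorNormalization (r : MonoidAlgebra ℤ (G₁ × G₂)) :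
    tensorToRat G₁ G₂ (toTensorNormalization G₁ G₂ r) = toRat (G₁ × G₂) r := by
  induction r using MonoidAlgebra.induction_linear with
  | zero => simp
  | add x y hx hy => simp only [map_add, hx, hy]
  | single g c =>
    have h : MonoidAlgebra.single g c = inlRing G₁ G₂ (MonoidAlgebra.single g.1 c) *
        inrRing G₁ G₂ (MonoidAlgebra.single g.2 1) := by
      simp [inlRing, inrRing, MonoidAlgebra.single_mul_single]
    conv_lhs => rw [h]
    rw [toTensorNormalization_mul, tensorToRat_tmul, normToRat_toNormalization,
      normToRat_toNormalization]
    simp [MonoidAlgebra.single_mul_single]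

theorem card_mul_mem_range_toNormalization {G : Type*} [CommGroup G] [Finite G]
    (s : Normalization (MonoidAlgebra ℤ G)) :
    ∃ r, toNormalization G r = (Nat.card G : Normalization (MonoidAlgebra ℤ G)) * s := by
  obtain ⟨r, hr⟩ := card_mul_mem_range_toRat (isIntegral_normToRat G s)
  refine ⟨r, normToRat_injective G ?_⟩
  rw [normToRat_toNormalization, hr, map_mul, map_natCast]

variable [Finite G₁] [Finite G₂]

theorem exists_card_mul_eq (x : Normalization (MonoidAlgebra ℤ G₁) ⊗[ℤ]
    Normalization (MonoidAlgebra ℤ G₂)) :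
    ∃ r, toTensorNormalization G₁ G₂ r = ((Nat.card G₁ * Nat.card G₂ : ℕ) : Normalization
      (MonoidAlgebra ℤ G₁) ⊗[ℤ] Normalization (MonoidAlgebra ℤ G₂)) * x := by
  induction x using TensorProduct.induction_on with
  | zero => exact ⟨0, by simp⟩
  | add x y hx hy =>
    obtain ⟨a, ha⟩ := hx
    obtain ⟨b, hb⟩ := hy
    exact ⟨a + b, by rw [map_add, ha, hb, mul_add]⟩
  | tmul s t =>
    obtain ⟨a, ha⟩ := card_mul_mem_range_toNormalization s
    obtain ⟨b, hb⟩ := card_mul_mem_range_toNormalization t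
    refine ⟨inlRing G₁ G₂ a * inrRing G₁ G₂ b, ?_⟩
    rw [toTensorNormalization_mul, ha, hb, ← nsmul_eq_mul, ← nsmul_eq_mul, ← nsmul_eq_mul,
      ← TensorProduct.smul_tmul', TensorProduct.tmul_smul, smul_smul]

/-- A multiple by `|G₁| |G₂|` comes from the integral group ring, where injectivity is clear; `S₁ ⊗
S₂` has no torsion, by flatness. -/
theorem tensorToRat_injective : Function.Injective (tensorToRat G₁ G₂) := by
  rw [injective_iff_map_eq_zero]
  intro x hx
  obtain ⟨r, hr⟩ := exists_card_mul_eq G₁ G₂ x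
  have h1 : toRat (G₁ × G₂) r = 0 := by
    rw [← tensorToRat_toTensorNormalization, hr, map_mul, hx, mul_zero]
  rw [toRat_injective (h1.trans (map_zero _).symm), map_zero, ← nsmul_eq_mul] at hr
  have h2 : Nat.card G₁ * Nat.card G₂ ≠ 0 := mul_ne_zero Nat.card_pos.ne' Nat.card_pos.ne'
  exact eq_zero_of_nsmul_tensorProduct ℤ _ _ h2 hr.symm

theorem isIntegral_tensorToRat (x : Normalization (MonoidAlgebra ℤ G₁) ⊗[ℤ]
    Normalization (MonoidAlgebra ℤ G₂)) : IsIntegral ℤ (tensorToRat G₁ G₂ x) := by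
  induction x using TensorProduct.induction_on with
  | zero => rw [map_zero]; exact isIntegral_zero
  | add x y hx hy => rw [map_add]; exact hx.add hy
  | tmul s t =>
    rw [tensorToRat_tmul]
    exact ((isIntegral_normToRat G₁ s).map
      (MonoidAlgebra.mapDomainRingHom ℚ (MonoidHom.inl G₁ G₂)).toIntAlgHom).mul
      ((isIntegral_normToRat G₂ t).map
      (MonoidAlgebra.mapDomainRingHom ℚ (MonoidHom.inr G₁ G₂)).toIntAlgHom)

end TensorNormalization

/-! ### `S₁ ⊗ S₂` as the normalization, for coprime orders -/

section Integral

variable {A B : Type*} [CommGroup A] [CommGroup B] [Finite A]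

/-- The coefficients over `ℚ[B]` of an integral element of `ℚ[A × B]` are integral up to `|A|`. -/
theorem exists_card_mul_eq_sum [Fintype A] {x : MonoidAlgebra ℚ (A × B)} (hx : IsIntegral ℤ x) :
    ∃ y : A → MonoidAlgebra ℚ B, (∀ a, IsIntegral ℤ (y a)) ∧
      (Nat.card A : MonoidAlgebra ℚ (A × B)) * x =
        ∑ a, MonoidAlgebra.mapDomainRingHom ℚ (MonoidHom.inl A B) (MonoidAlgebra.single a 1) *
          MonoidAlgebra.mapDomainRingHom ℚ (MonoidHom.inr A B) (y a) := by
  classical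
  let c : MonoidAlgebra ℚ (A × B) ≃+* MonoidAlgebra (MonoidAlgebra ℚ B) A :=
    MonoidAlgebra.curryRingEquiv
  refine ⟨fun a => (Nat.card A : MonoidAlgebra ℚ B) * (c x).coeff a, fun a => ?_, ?_⟩
  -- Fourier inversion over the coefficient ring `ℚ[B]`, extended to `ℂ[B]`.
  · refine isIntegral_card_mul_coeff (MonoidAlgebra.mapRingHom B (algebraMap ℚ ℂ))
      (MonoidAlgebra.map_injective (algebraMap ℚ ℂ : ℚ →+ ℂ) (algebraMap ℚ ℂ).injective) ?_ a
    exact hx.map c.toRingHom.toIntAlgHom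
  · simp only [map_mul, map_natCast, mul_left_comm _ (Nat.card A : MonoidAlgebra ℚ (A × B))]
    rw [← Finset.mul_sum]
    congr 1
    clear hx
    induction x using MonoidAlgebra.induction_linear with
    | zero => simp
    | add x y hx hy =>
      simp only [map_add, MonoidAlgebra.coeff_add, Finsupp.add_apply, mul_add,
        Finset.sum_add_distrib, ← hx, ← hy]
    | single g q =>
      obtain ⟨a, b⟩ := g
      rw [Finset.sum_eq_single a]
      · simp [c, MonoidAlgebra.curryRingEquiv_single, MonoidAlgebra.single_mul_single]
      · intro a' _ ha
        simp [c, MonoidAlgebra.curryRingEquiv_single, Ne.symm ha]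
      · simp

end Integral

section Normal

variable (G₁ G₂ : Type*) [CommGroup G₁] [CommGroup G₂] [Finite G₁] [Finite G₂]

/-- Expanding along either factor puts `|G₁| x` and `|G₂| x` in the image; a Bézout relation gives
`x`. -/
theorem exists_tensorToRat_eq (hcop : (Nat.card G₁).Coprime (Nat.card G₂))
    {x : MonoidAlgebra ℚ (G₁ × G₂)} (hx : IsIntegral ℤ x) : ∃ s, tensorToRat G₁ G₂ s = x := by
  have := Fintype.ofFinite G₁
  have := Fintype.ofFinite G₂
  have h1 : ∃ s, tensorToRat G₁ G₂ s = (Nat.card G₁ : MonoidAlgebra ℚ (G₁ × G₂)) * x := by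
    obtain ⟨y, hy, hxy⟩ := exists_card_mul_eq_sum hx
    choose t ht using fun a => exists_normToRat_eq G₂ (hy a)
    refine ⟨∑ a, toNormalization G₁ (MonoidAlgebra.single a 1) ⊗ₜ t a, ?_⟩
    rw [hxy, map_sum]
    simp only [tensorToRat_tmul, normToRat_toNormalization, toRat_single, Int.cast_one, ht]
  have h2 : ∃ s, tensorToRat G₁ G₂ s = (Nat.card G₂ : MonoidAlgebra ℚ (G₁ × G₂)) * x := by
    let σ := MonoidAlgebra.mapDomainRingEquiv ℚ (MulEquiv.prodComm (M := G₁) (N := G₂))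
    obtain ⟨y, hy, hxy⟩ := exists_card_mul_eq_sum (hx.map σ.toRingHom.toIntAlgHom)
    choose t ht using fun a => exists_normToRat_eq G₁ (hy a)
    refine ⟨∑ a, t a ⊗ₜ toNormalization G₂ (MonoidAlgebra.single a 1), ?_⟩
    have hl : ∀ z, σ (MonoidAlgebra.mapDomainRingHom ℚ (MonoidHom.inl G₁ G₂) z) =
        MonoidAlgebra.mapDomainRingHom ℚ (MonoidHom.inr G₂ G₁) z := fun z => by
      induction z using MonoidAlgebra.induction_linear with
      | zero => simp
      | add x y hx hy => simp only [map_add, hx, hy]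
      | single g c => simp [σ]
    have hr : ∀ z, σ (MonoidAlgebra.mapDomainRingHom ℚ (MonoidHom.inr G₁ G₂) z) =
        MonoidAlgebra.mapDomainRingHom ℚ (MonoidHom.inl G₂ G₁) z := fun z => by
      induction z using MonoidAlgebra.induction_linear with
      | zero => simp
      | add x y hx hy => simp only [map_add, hx, hy]
      | single g c => simp [σ]
    apply σ.injective
    rw [map_mul, map_natCast]
    refine Eq.trans ?_ hxy.symm
    rw [map_sum, map_sum]
    simp only [tensorToRat_tmul, normToRat_toNormalization, toRat_single, Int.cast_one, ht, map_mul,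
      hl, hr, mul_comm]
  obtain ⟨s, hs⟩ := h1
  obtain ⟨t, ht⟩ := h2
  obtain ⟨u, v, huv⟩ := Nat.isCoprime_iff_coprime.2 hcop
  refine ⟨u * s + v * t, ?_⟩
  have huv' : (u * Nat.card G₁ + v * Nat.card G₂ : MonoidAlgebra ℚ (G₁ × G₂)) = 1 := by
    exact_mod_cast congrArg (Int.cast : ℤ → MonoidAlgebra ℚ (G₁ × G₂)) huv
  rw [map_add, map_mul, map_mul, hs, ht, map_intCast, map_intCast]
  linear_combination x * huv'

/-- For groups of coprime orders, `S₁ ⊗ S₂` is the normalization of `ℤ[G₁ × G₂]`. -/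
theorem exists_tensorNormalization_equiv (hcop : (Nat.card G₁).Coprime (Nat.card G₂)) :
    ∃ φ : Normalization (MonoidAlgebra ℤ G₁) ⊗[ℤ] Normalization (MonoidAlgebra ℤ G₂) ≃+*
        Normalization (MonoidAlgebra ℤ (G₁ × G₂)),
      ∀ r, φ (toTensorNormalization G₁ G₂ r) = toNormalization _ r := by
  have hrange : (tensorToRat G₁ G₂).range = (normToRat (G₁ × G₂)).range := by
    ext x
    constructor
    · rintro ⟨s, rfl⟩
      exact exists_normToRat_eq _ (isIntegral_tensorToRat G₁ G₂ s)
    · rintro ⟨s, rfl⟩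
      exact exists_tensorToRat_eq G₁ G₂ hcop (isIntegral_normToRat _ s)
  let φ₁ := RingEquiv.ofBijective (tensorToRat G₁ G₂).rangeRestrict
    ⟨fun a b h => tensorToRat_injective G₁ G₂ (congrArg Subtype.val h),
      (tensorToRat G₁ G₂).rangeRestrict_surjective⟩
  let φ₂ := RingEquiv.ofBijective (normToRat (G₁ × G₂)).rangeRestrict
    ⟨fun a b h => normToRat_injective _ (congrArg Subtype.val h),
      (normToRat (G₁ × G₂)).rangeRestrict_surjective⟩
  refine ⟨(φ₁.trans (RingEquiv.subringCongr hrange)).trans φ₂.symm, fun r => ?_⟩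
  rw [RingEquiv.trans_apply, RingEquiv.symm_apply_eq]
  apply Subtype.ext
  change tensorToRat G₁ G₂ _ = normToRat _ _
  rw [tensorToRat_toTensorNormalization, normToRat_toNormalization]

end Normal

/-! ### Coordinates and ideals in tensor products -/

section Slices

variable {R M N ι : Type*} [CommRing R] [AddCommGroup M] [AddCommGroup N] [Module R M]
  [Module R N] [Fintype ι]

/-- The family `b` need not span: flatness of `M` keeps `R^ι → N` injective after tensoring. -/
theorem sum_tmul_right_injective [Module.Flat R M] {b : ι → N} (hb : LinearIndependent R b)
    {c c' : ι → M} (h : ∑ i, c i ⊗ₜ[R] b i = ∑ i, c' i ⊗ₜ[R] b i) : c = c' := by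
  classical
  have hinj : Function.Injective ((Fintype.linearCombination R b).lTensor M) :=
    Module.Flat.lTensor_preserves_injective_linearMap _
      (linearIndependent_iff_injective_fintypeLinearCombination.1 hb)
  have key : ∀ c : ι → M, (Fintype.linearCombination R b).lTensor M
      (∑ i, c i ⊗ₜ Pi.single i 1) = ∑ i, c i ⊗ₜ b i := fun c => by
    rw [map_sum]
    simp
  rw [← key, ← key] at h
  have h2 := congrArg (TensorProduct.piScalarRight R R M ι) (hinj h)
  have key2 : ∀ c : ι → M, TensorProduct.piScalarRight R R M ι (∑ i, c i ⊗ₜ Pi.single i 1) = c :=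
    fun c => by
      ext j
      rw [map_sum, Finset.sum_apply]
      simp [Pi.single_apply]
  rwa [key2, key2] at h2

theorem sum_tmul_left_injective [Module.Flat R N] {b : ι → M} (hb : LinearIndependent R b)
    {c c' : ι → N} (h : ∑ i, b i ⊗ₜ[R] c i = ∑ i, b i ⊗ₜ[R] c' i) : c = c' := by
  apply sum_tmul_right_injective hb
  simpa using congrArg (TensorProduct.comm R M N) h

end Slices

section IdealTensor

variable {S T : Type*} [CommRing S] [CommRing T]

/-- The ideal of `S ⊗ T` that is the image of `I ⊗ J`. -/
def tensorIdeal (I : Ideal S) (J : Ideal T) : Ideal (S ⊗[ℤ] T) where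
  carrier := LinearMap.range (TensorProduct.mapIncl (I.restrictScalars ℤ) (J.restrictScalars ℤ))
  zero_mem' := zero_mem _
  add_mem' := add_mem
  smul_mem' := by
    rintro c _ ⟨x, rfl⟩
    rw [smul_eq_mul]
    induction x using TensorProduct.induction_on with
    | zero => rw [map_zero, mul_zero]; exact zero_mem _
    | add x y hx hy => rw [map_add, mul_add]; exact add_mem hx hy
    | tmul a b =>
      induction c using TensorProduct.induction_on with
      | zero => rw [zero_mul]; exact zero_mem _
      | add x y hx hy => rw [add_mul]; exact add_mem hx hy
      | tmul s t => exact ⟨⟨s * a, I.mul_mem_left s a.2⟩ ⊗ₜ ⟨t * b, J.mul_mem_left t b.2⟩,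
        (Algebra.TensorProduct.tmul_mul_tmul s (a : S) t (b : T)).symm⟩

theorem mem_tensorIdeal {I : Ideal S} {J : Ideal T} {x : S ⊗[ℤ] T} :
    x ∈ tensorIdeal I J ↔ x ∈ LinearMap.range
      (TensorProduct.mapIncl (I.restrictScalars ℤ) (J.restrictScalars ℤ)) := Iff.rfl

theorem tmul_mem_tensorIdeal {I : Ideal S} {J : Ideal T} {a : S} {b : T} (ha : a ∈ I)
    (hb : b ∈ J) : a ⊗ₜ[ℤ] b ∈ tensorIdeal I J :=
  ⟨(⟨a, ha⟩ : I.restrictScalars ℤ) ⊗ₜ (⟨b, hb⟩ : J.restrictScalars ℤ), rfl⟩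

theorem tensorIdeal_mono {I I' : Ideal S} {J J' : Ideal T} (hI : I ≤ I') (hJ : J ≤ J') :
    tensorIdeal I J ≤ tensorIdeal I' J' := by
  rintro _ ⟨x, rfl⟩
  induction x using TensorProduct.induction_on with
  | zero => rw [map_zero]; exact zero_mem _
  | add x y hx hy => rw [map_add]; exact add_mem hx hy
  | tmul a b => exact tmul_mem_tensorIdeal (hI a.2) (hJ b.2)

end IdealTensor

/-! ### `λ`-ideals of `S₁ ⊗ S₂` -/

section TensorLambda

variable {G₁ G₂ : Type*} [CommGroup G₁] [CommGroup G₂]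

theorem theta_mul {G : Type*} [CommGroup G] {l : ℕ} (hl : l.Prime) (a b : MonoidAlgebra ℤ G) :
    theta hl (a * b) = a ^ l * theta hl b + theta hl a * adams G l b := by
  apply theta_unique
  rw [map_mul, mul_add, mul_left_comm, theta_spec, ← mul_assoc, theta_spec]
  ring

theorem isLambdaIdeal_tensorIdeal {I : Ideal (Normalization (MonoidAlgebra ℤ G₁))}
    {J : Ideal (Normalization (MonoidAlgebra ℤ G₂))} (hI : IsLambdaIdeal (toNormalization G₁) I)
    (hJ : IsLambdaIdeal (toNormalization G₂) J) :
    IsLambdaIdeal (toTensorNormalization G₁ G₂) (tensorIdeal I J) := by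
  -- The existential form passes through the induction on tensors; by injectivity `w` is the only
  -- preimage.
  have key : ∀ x ∈ tensorIdeal I J, ∃ w, toTensorNormalization G₁ G₂ w = x ∧
      ∀ (l : ℕ) (hl : l.Prime), toTensorNormalization G₁ G₂ (theta hl w) ∈ tensorIdeal I J := by
    rintro _ ⟨x, rfl⟩
    induction x using TensorProduct.induction_on with
    | zero => exact ⟨0, by simp, fun l hl => by rw [theta_zero, map_zero]; exact zero_mem _⟩
    | add x y hx hy =>
      obtain ⟨a, ha, ha'⟩ := hx
      obtain ⟨b, hb, hb'⟩ := hy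
      refine ⟨a + b, by rw [map_add, map_add, ha, hb], fun l hl => ?_⟩
      obtain ⟨r, hr⟩ := exists_theta_add hl a b
      rw [hr, map_add, map_add, map_mul, ha]
      exact add_mem (add_mem (ha' l hl) (hb' l hl)) (Ideal.mul_mem_right _ _ ⟨x, rfl⟩)
    | tmul s t =>
      obtain ⟨⟨s, hs⟩, ⟨t, ht⟩⟩ := s, t
      obtain ⟨a, rfl⟩ := hI.1 s hs
      obtain ⟨b, rfl⟩ := hJ.1 t ht
      refine ⟨inlRing G₁ G₂ a * inrRing G₁ G₂ b, toTensorNormalization_mul G₁ G₂ a b,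
        fun l hl => ?_⟩
      have hψ : toNormalization G₂ (adams G₂ l b) ∈ J := by
        have h1 : adams G₂ l b = b ^ l - l * theta hl b := by rw [theta_spec]; ring
        rw [h1, map_sub, map_pow, map_mul]
        exact sub_mem (Ideal.pow_mem_of_mem _ ht _ hl.pos) (J.mul_mem_left _ (hJ.2 l hl b ht))
      rw [theta_mul, inlRing, theta_mapDomain, inrRing, theta_mapDomain, adams_mapDomain,
        ← inlRing, ← inrRing, ← map_pow, map_add, toTensorNormalization_mul,
        toTensorNormalization_mul]
      refine add_mem (tmul_mem_tensorIdeal ?_ (hJ.2 l hl b ht))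
        (tmul_mem_tensorIdeal (hI.2 l hl a hs) hψ)
      rw [map_pow]
      exact Ideal.pow_mem_of_mem _ hs _ hl.pos
  refine ⟨fun x hx => ?_, fun l hl a ha => ?_⟩
  · obtain ⟨w, hw, -⟩ := key x hx
    exact ⟨w, hw⟩
  · obtain ⟨w, hw, hw'⟩ := key _ ha
    rw [← toTensorNormalization_injective G₁ G₂ hw]
    exact hw' l hl

theorem toTensorNormalization_eq_sum [Fintype G₂] (a : MonoidAlgebra ℤ (G₁ × G₂)) :
    ∃ r : G₂ → MonoidAlgebra ℤ G₁, toTensorNormalization G₁ G₂ a =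
      ∑ g, toNormalization G₁ (r g) ⊗ₜ toNormalization G₂ (MonoidAlgebra.single g 1) := by
  classical
  induction a using MonoidAlgebra.induction_linear with
  | zero => exact ⟨0, by simp⟩
  | add x y hx hy =>
    obtain ⟨r, hr⟩ := hx
    obtain ⟨s, hs⟩ := hy
    refine ⟨r + s, ?_⟩
    simp only [map_add, hr, hs, Pi.add_apply, TensorProduct.add_tmul, Finset.sum_add_distrib]
  | single g c =>
    have h : MonoidAlgebra.single g c = inlRing G₁ G₂ (MonoidAlgebra.single g.1 c) *
        inrRing G₁ G₂ (MonoidAlgebra.single g.2 1) := by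
      simp [inlRing, inrRing, MonoidAlgebra.single_mul_single]
    refine ⟨Pi.single g.2 (MonoidAlgebra.single g.1 c), ?_⟩
    rw [h, toTensorNormalization_mul, Finset.sum_eq_single g.2]
    · rw [Pi.single_eq_same]
    · intro g' _ hg'
      rw [Pi.single_eq_of_ne hg', map_zero, TensorProduct.zero_tmul]
    · simp

theorem exists_card_mul_eq_norm (G : Type*) [CommGroup G] [Finite G] :
    ∃ ε : Normalization (MonoidAlgebra ℤ G),
      (Nat.card G : Normalization (MonoidAlgebra ℤ G)) * ε = toNormalization G (norm ⊤) := by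
  obtain ⟨ε, hε⟩ := exists_normToRat_eq G (isIntegral_idem ⊤)
  refine ⟨ε, normToRat_injective G ?_⟩
  rw [map_mul, map_natCast, hε, normToRat_toNormalization, ← card_mul_idem, Subgroup.card_top]

theorem linearIndependent_toNormalization_single (G : Type*) [CommGroup G] [Fintype G] :
    LinearIndependent ℤ (fun g : G => toNormalization G (MonoidAlgebra.single g 1)) := by
  rw [Fintype.linearIndependent_iff]
  intro c hc g
  have h1 : toNormalization G (∑ g, MonoidAlgebra.single g (c g)) = 0 := by
    rw [map_sum, ← hc]
    refine Finset.sum_congr rfl fun g _ => ?_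
    rw [← map_zsmul, MonoidAlgebra.smul_single, smul_eq_mul, mul_one]
  have h2 := toNormalization_injective G (h1.trans (map_zero _).symm)
  have h3 := congrArg (fun z : MonoidAlgebra ℤ G => z.coeff g) h2
  classical
  simpa [MonoidAlgebra.coeff_sum, Finsupp.single_apply] using h3

theorem finite_reducedConductor (G : Type*) [CommGroup G] [Finite G] :
    Module.Finite ℤ ((reducedConductor G).restrictScalars ℤ) := by
  have hle : (reducedConductor G).restrictScalars ℤ ≤
      LinearMap.range (toNormalization G).toIntAlgHom.toLinearMap := fun s hs => by
    have := hs.1 1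
    rwa [mul_one] at this
  have : Module.Finite ℤ (MonoidAlgebra ℤ G) := inferInstance
  have : Module.Finite ℤ (LinearMap.range (toNormalization G).toIntAlgHom.toLinearMap) :=
    Module.Finite.range _
  exact Module.Finite.of_injective (Submodule.inclusion hle) (Submodule.inclusion_injective hle)

variable [Finite G₁] [Finite G₂]

theorem norm_tmul_one_mul_eq_zero {p e : ℕ} (hp : p.Prime) (hG : Nat.card G₁ = p ^ e)
    (hcop : (Nat.card G₁).Coprime (Nat.card G₂)) (hn : Nontrivial G₁) {I : Ideal
      (Normalization (MonoidAlgebra ℤ G₁) ⊗[ℤ] Normalization (MonoidAlgebra ℤ G₂))}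
    (hI : IsLambdaIdeal (toTensorNormalization G₁ G₂) I) {x} (hx : x ∈ I) :
    (toNormalization G₁ (norm ⊤) ⊗ₜ 1) * x = 0 := by
  obtain ⟨ε, hε⟩ := exists_card_mul_eq_norm G₁
  obtain _ | e := e
  · exact absurd hG Finite.one_lt_card.ne'
  rw [← toTensorNormalization_inl]
  refine norm_mul_eq_zero_of_isLambdaIdeal hp hG ?_ (toTensorNormalization_injective G₁ G₂)
    (ε := ε ⊗ₜ 1) ?_ hI hx
  · rw [hG] at hcop
    exact hcop.coprime_dvd_left (dvd_pow_self _ e.succ_ne_zero)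
  · rw [toTensorNormalization_inl, ← hε, ← nsmul_eq_mul, ← nsmul_eq_mul, TensorProduct.smul_tmul']

theorem one_tmul_norm_mul_eq_zero {p e : ℕ} (hp : p.Prime) (hG : Nat.card G₂ = p ^ e)
    (hcop : (Nat.card G₂).Coprime (Nat.card G₁)) (hn : Nontrivial G₂) {I : Ideal
      (Normalization (MonoidAlgebra ℤ G₁) ⊗[ℤ] Normalization (MonoidAlgebra ℤ G₂))}
    (hI : IsLambdaIdeal (toTensorNormalization G₁ G₂) I) {x} (hx : x ∈ I) :
    (1 ⊗ₜ toNormalization G₂ (norm ⊤)) * x = 0 := by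
  obtain ⟨ε, hε⟩ := exists_card_mul_eq_norm G₂
  obtain _ | e := e
  · exact absurd hG Finite.one_lt_card.ne'
  -- The factors are swapped so that the descent, stated for the first factor, applies.
  let E : G₂ × G₁ ≃* G₁ × G₂ := MulEquiv.prodComm
  have hE : MonoidAlgebra.mapDomainRingHom ℤ E.toMonoidHom (inlRing G₂ G₁ (norm ⊤)) =
      inrRing G₁ G₂ (norm ⊤) := by
    rw [inlRing, ← RingHom.comp_apply, ← MonoidAlgebra.mapDomainRingHom_comp]
    rfl
  have hEinj : Function.Injective (MonoidAlgebra.mapDomainRingHom ℤ E.toMonoidHom) :=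
    MonoidAlgebra.mapDomain_injective E.injective
  have h := norm_mul_eq_zero_of_isLambdaIdeal hp hG ?_
    ((toTensorNormalization_injective G₁ G₂).comp hEinj : Function.Injective
      ((toTensorNormalization G₁ G₂).comp (MonoidAlgebra.mapDomainRingHom ℤ E.toMonoidHom)))
    (ε := 1 ⊗ₜ ε) ?_ (hI.comp_mulEquiv E) hx
  · rwa [RingHom.comp_apply, hE, toTensorNormalization_inr] at h
  · rw [hG] at hcop
    exact hcop.coprime_dvd_left (dvd_pow_self _ e.succ_ne_zero)
  · rw [RingHom.comp_apply, hE, toTensorNormalization_inr, ← hε, ← nsmul_eq_mul, ← nsmul_eq_mul,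
      TensorProduct.tmul_smul]

/-- The coordinates along the basis `G₂` of `R₂` are unique, so multiplying `x` by `t ⊗ 1` (still in
`R₁ ⊗ R₂`) or by the norm of `G₁` acts on each coordinate separately. -/
theorem exists_eq_sum_reducedConductor [Fintype G₂] {p e : ℕ} (hp : p.Prime)
    (hG : Nat.card G₁ = p ^ e) (hcop : (Nat.card G₁).Coprime (Nat.card G₂)) {I : Ideal
      (Normalization (MonoidAlgebra ℤ G₁) ⊗[ℤ] Normalization (MonoidAlgebra ℤ G₂))}
    (hI : IsLambdaIdeal (toTensorNormalization G₁ G₂) I) {x} (hx : x ∈ I) :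
    ∃ r : G₂ → Normalization (MonoidAlgebra ℤ G₁), (∀ g, r g ∈ reducedConductor G₁) ∧
      x = ∑ g, r g ⊗ₜ toNormalization G₂ (MonoidAlgebra.single g 1) := by
  have hli := linearIndependent_toNormalization_single G₂
  obtain ⟨a, rfl⟩ := hI.1 x hx
  obtain ⟨r, hr⟩ := toTensorNormalization_eq_sum a
  have hmul : ∀ s : Normalization (MonoidAlgebra ℤ G₁), (s ⊗ₜ 1) * toTensorNormalization G₁ G₂ a =
      ∑ g, (s * toNormalization G₁ (r g)) ⊗ₜ toNormalization G₂ (MonoidAlgebra.single g 1) := by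
    intro s
    rw [hr, Finset.mul_sum]
    simp only [Algebra.TensorProduct.tmul_mul_tmul, one_mul]
  refine ⟨fun g => toNormalization G₁ (r g), fun g => ⟨fun t => ?_, fun hn => ?_⟩, hr⟩
  · obtain ⟨b, hb⟩ := hI.1 _ (I.mul_mem_left (t ⊗ₜ 1) hx)
    obtain ⟨r', hr'⟩ := toTensorNormalization_eq_sum b
    rw [hb, hmul] at hr'
    have := congrFun (sum_tmul_right_injective hli hr') g
    rw [mul_comm]
    exact ⟨_, this.symm⟩
  · have h1 := norm_tmul_one_mul_eq_zero hp hG hcop hn hI hx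
    rw [hmul] at h1
    have h2 : ∑ g : G₂, (0 : G₂ → Normalization (MonoidAlgebra ℤ G₁)) g ⊗ₜ[ℤ]
        toNormalization G₂ (MonoidAlgebra.single g 1) = 0 := by simp
    have := congrFun (sum_tmul_right_injective hli (h1.trans h2.symm)) g
    rw [mul_comm]
    exact this

/-- A `λ`-ideal of `S₁ ⊗ S₂` is contained in the tensor product of the reduced conductors. -/
theorem IsLambdaIdeal.le_tensorIdeal {p q e f : ℕ} (hp : p.Prime) (hq : q.Prime) (hpq : p ≠ q)
    (hG₁ : Nat.card G₁ = p ^ e) (hG₂ : Nat.card G₂ = q ^ f) {I : Ideal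
      (Normalization (MonoidAlgebra ℤ G₁) ⊗[ℤ] Normalization (MonoidAlgebra ℤ G₂))}
    (hI : IsLambdaIdeal (toTensorNormalization G₁ G₂) I) :
    I ≤ tensorIdeal (reducedConductor G₁) (reducedConductor G₂) := by
  have := Fintype.ofFinite G₂
  have hcop : (Nat.card G₁).Coprime (Nat.card G₂) := by
    rw [hG₁, hG₂]
    exact Nat.Coprime.pow _ _ ((Nat.coprime_primes hp hq).2 hpq)
  let K := (reducedConductor G₁).restrictScalars ℤ
  have := finite_reducedConductor G₁
  -- The reduced conductor is a subgroup of `ℤ[G₁]`, hence free of finite rank; the coordinates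
  -- along this basis are then studied in the second factor.
  let b := Module.Free.chooseBasis ℤ K
  have hli : LinearIndependent ℤ (fun i => (b i : Normalization (MonoidAlgebra ℤ G₁))) :=
    b.linearIndependent.map' K.subtype (Submodule.ker_subtype K)
  have slice : ∀ x ∈ I, ∃ y : Module.Free.ChooseBasisIndex ℤ K → MonoidAlgebra ℤ G₂,
      x = ∑ i, (b i : Normalization (MonoidAlgebra ℤ G₁)) ⊗ₜ toNormalization G₂ (y i) := by
    intro x hx
    obtain ⟨r, hr, rfl⟩ := exists_eq_sum_reducedConductor hp hG₁ hcop hI hx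
    refine ⟨fun i => ∑ g, b.repr ⟨r g, hr g⟩ i • MonoidAlgebra.single g 1, ?_⟩
    simp only [map_sum, map_zsmul, TensorProduct.tmul_sum]
    rw [Finset.sum_comm]
    refine Finset.sum_congr rfl fun g _ => ?_
    simp only [TensorProduct.tmul_smul, TensorProduct.smul_tmul', ← TensorProduct.sum_tmul]
    congr 1
    have := congrArg Subtype.val (b.sum_repr ⟨r g, hr g⟩)
    rw [← Submodule.subtype_apply, map_sum] at this
    exact this.symm
  intro x hx
  obtain ⟨y, hy⟩ := slice x hx
  have hmul : ∀ t : Normalization (MonoidAlgebra ℤ G₂), (1 ⊗ₜ t) * x =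
      ∑ i, (b i : Normalization (MonoidAlgebra ℤ G₁)) ⊗ₜ (t * toNormalization G₂ (y i)) := by
    intro t
    rw [hy, Finset.mul_sum]
    simp only [Algebra.TensorProduct.tmul_mul_tmul, one_mul]
  rw [hy]
  refine sum_mem fun i _ => tmul_mem_tensorIdeal (b i).2 ⟨fun t => ?_, fun hn => ?_⟩
  · obtain ⟨y', hy'⟩ := slice _ (I.mul_mem_left (1 ⊗ₜ t) hx)
    rw [hmul] at hy'
    have := congrFun (sum_tmul_left_injective hli hy') i
    rw [mul_comm]
    exact ⟨_, this.symm⟩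
  · have h1 := one_tmul_norm_mul_eq_zero hq hG₂ hcop.symm hn hI hx
    rw [hmul] at h1
    have h2 : ∑ i, (b i : Normalization (MonoidAlgebra ℤ G₁)) ⊗ₜ[ℤ]
      (0 : Module.Free.ChooseBasisIndex ℤ K → Normalization (MonoidAlgebra ℤ G₂)) i = 0 := by simp
    have := congrFun (sum_tmul_left_injective hli (h1.trans h2.symm)) i
    rw [mul_comm]
    exact this

end TensorLambda

end GroupRing

end

theorem mainTheorem2 (p q e f : ℕ) (hp : p.Prime) (hq : q.Prime) (hpq : p ≠ q)
    (G₁ G₂ : Type*) [CommGroup G₁] [CommGroup G₂]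
    (hG₁ : Nat.card G₁ = p ^ e) (hG₂ : Nat.card G₂ = q ^ f) :
    -- `S₁ ⊗ S₂` is the normalization of `ℤ[G₁ × G₂] = R₁ ⊗ R₂`
    (∃ φ : GroupRing.Normalization (MonoidAlgebra ℤ G₁) ⊗[ℤ]
          GroupRing.Normalization (MonoidAlgebra ℤ G₂) ≃+*
          GroupRing.Normalization (MonoidAlgebra ℤ (G₁ × G₂)),
        ∀ r, φ (GroupRing.toTensorNormalization G₁ G₂ r) = GroupRing.toNormalization _ r) ∧
    -- `I₁λ ⊗ I₂λ` is a subgroup of `S₁ ⊗ S₂`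
    Function.Injective (TensorProduct.mapIncl
      ((GroupRing.lambdaConductor (GroupRing.toNormalization G₁)).restrictScalars ℤ)
      ((GroupRing.lambdaConductor (GroupRing.toNormalization G₂)).restrictScalars ℤ)) ∧
    -- and this subgroup is the `λ`-conductor of `S₁ ⊗ S₂` into `R₁ ⊗ R₂`
    (GroupRing.lambdaConductor (GroupRing.toTensorNormalization G₁ G₂)).restrictScalars ℤ =
      LinearMap.range (TensorProduct.mapIncl
        ((GroupRing.lambdaConductor (GroupRing.toNormalization G₁)).restrictScalars ℤ)
        ((GroupRing.lambdaConductor (GroupRing.toNormalization G₂)).restrictScalars ℤ)) := by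

  have : Finite G₁ := Nat.finite_of_card_ne_zero (hG₁ ▸ pow_ne_zero _ hp.ne_zero)
  have : Finite G₂ := Nat.finite_of_card_ne_zero (hG₂ ▸ pow_ne_zero _ hq.ne_zero)
  have hcop : (Nat.card G₁).Coprime (Nat.card G₂) := by
    rw [hG₁, hG₂]
    exact Nat.Coprime.pow _ _ ((Nat.coprime_primes hp hq).2 hpq)
  have hinj₁ := GroupRing.toNormalization_injective G₁
  have hinj₂ := GroupRing.toNormalization_injective G₂
  have hinj := GroupRing.toTensorNormalization_injective G₁ G₂
  refine ⟨GroupRing.exists_tensorNormalization_equiv G₁ G₂ hcop,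
    TensorProduct.map_injective_of_flat_flat _ _ Subtype.val_injective Subtype.val_injective, ?_⟩
  have h : GroupRing.lambdaConductor (GroupRing.toTensorNormalization G₁ G₂) =
      GroupRing.tensorIdeal (GroupRing.lambdaConductor (GroupRing.toNormalization G₁))
        (GroupRing.lambdaConductor (GroupRing.toNormalization G₂)) := by
    -- Both directions use maximality of a `λ`-conductor: of the two factors for `≤`, of the tensor
    -- product for `≥`.
    refine le_antisymm ?_ ?_
    · exact ((GroupRing.isGreatest_lambdaConductor hinj).1.le_tensorIdeal hp hq hpq hG₁ hG₂).trans
        (GroupRing.tensorIdeal_mono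
          ((GroupRing.isGreatest_lambdaConductor hinj₁).2
            (GroupRing.isLambdaIdeal_reducedConductor hp hG₁))
          ((GroupRing.isGreatest_lambdaConductor hinj₂).2
            (GroupRing.isLambdaIdeal_reducedConductor hq hG₂)))
    · exact (GroupRing.isGreatest_lambdaConductor hinj).2
        (GroupRing.isLambdaIdeal_tensorIdeal (GroupRing.isGreatest_lambdaConductor hinj₁).1
          (GroupRing.isGreatest_lambdaConductor hinj₂).1)
  ext x
  rw [Submodule.restrictScalars_mem, h, GroupRing.mem_tensorIdeal]
  exact Iff.rfl
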